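/- Let $G=(V,E)$ be a finite graph. An edge $2$-coloring of $G$ is a map $\sigma:E\to\mathbb N$ such that every vertex is incident to edges of at most $2$ different colors; the min-max edge $2$-coloring problem asks for an edge $2$-coloring that minimizes the size $\max_k|\{e\in E:\sigma(e)=k\}|$ of the largest color group. Consider the following algorithm for a tree $T$ on the vertices $0,\dots,n-1$, given by its adjacency matrix, with maximum degree $\Delta$. If $\Delta\le 1$, it returns $m=\Delta$ and gives all edges one color. Otherwise it sets $m\leftarrow\Delta-1$ and does the following for each vertex $r$, taken as the root. * Label every vertex with its distance from $r$ by breadth-first search. Set $l\leftarrow\lceil\Delta/2\rceil$, $u\leftarrow\Delta-1$. Repeat the following test until $l=u$ and a coloring $U$ has been stored for this root. * Test: set $c\leftarrow\lfloor(l+u)/2\rfloor$, erase the current coloring, and give each vertex $v\neq r$ the residual number $v_l\leftarrow 1$ and the root the residual number $0$. Go through the vertices $v$ that have children in descending order of distance from $r$. For each of them, choose by dynamic programming (a table indexed by the number of items and the capacity) a set $S$ of children of $v$ whose residual numbers have the largest possible sum not exceeding $c$, and let $R$ be the sum of the residual numbers of the children outside $S$. If $R+v_l>c$, the test fails: set $l\leftarrow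 c+1$. If not, color all uncolored edges incident to the vertices of $S$ and to their descendants with one new color, and set $v_l\leftarrow v_l+R$. If no vertex makes the test fail, color the remaining uncolored edges with one new color, store the coloring as $U$, and set $u\leftarrow c$. * After the repetition, if $u\le m$, set $m\leftarrow u$ and $M\leftarrow U$. The output is $m$ and the coloring $M$. **Theorem.** There is a polynomial $p$ such that, for every $n$ and every tree $T$ on $n$ vertices, this algorithm, written as an explicit program for a random access machine (registers and arrays of natural numbers; addition, truncated subtraction, halving, comparisons, assignments, branching and while-loops; every elementary command or branching decision counts as one step), halts on input $T$ after at most $p(n)$ steps, and its output is feasible and optimal: $M$ assigns a color to every edge of $T$, it is an edge $2$-coloring, the size of its largest color group is $m$, and no edge $2$-coloring of $T$ has a smaller largest color group. -/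

import Mathlib

/-! ## The min-max edge `q`-coloring problem -/

namespace MinMaxColoring

section Problem

variable {V K : Type*} {G : SimpleGraph V}

/-- The set of colors on the edges incident to the vertex `v`. -/
def colorsAt (χ : G.EdgeLabeling K) (v : V) : Set K :=
  {k | ∃ e : G.edgeSet, v ∈ e.1 ∧ χ e = k}

/-- A feasible solution: at most `q` different colors are incident to each vertex. -/
def IsEdgeQColoring (q : ℕ) (χ : G.EdgeLabeling K) : Prop :=
  ∀ v, (colorsAt χ v).encard ≤ q

/-- The size of a largest color group. -/
noncomputable def largestGroup (χ : G.EdgeLabeling K) : ℕ∞ :=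
  ⨆ k : K, {e : G.edgeSet | χ e = k}.encard

/-- A feasible and optimal solution of the min-max edge `q`-coloring problem on `G`. -/
def IsOptimal (q : ℕ) (χ : G.EdgeLabeling ℕ) : Prop :=
  IsEdgeQColoring q χ ∧
    ∀ χ' : G.EdgeLabeling ℕ, IsEdgeQColoring q χ' → largestGroup χ ≤ largestGroup χ'

end Problem

/-! ## A random access machine with a step count

Finitely many registers and finitely many (two-dimensional, unbounded) arrays hold natural
numbers. The only arithmetic operations are addition, truncated subtraction and halving (no
multiplication), so that unit cost per step is polynomially equivalent to Turing machine time. -/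

section Machine

/-- Arithmetic expressions over register names `R` and array names `A`. -/
inductive Exp (R A : Type) : Type
  | lit (k : ℕ)
  | reg (x : R)
  | cell (a : A) (i j : Exp R A)
  | add (e f : Exp R A)
  | sub (e f : Exp R A)
  | half (e : Exp R A)

/-- Tests that control branching. -/
inductive Test (R A : Type) : Type
  | le (e f : Exp R A)
  | lt (e f : Exp R A)
  | eq (e f : Exp R A)
  | and (b b' : Test R A)
  | not (b : Test R A)

/-- Commands. -/
inductive Cmd (R A : Type) : Type
  | skip
  | set (x : R) (e : Exp R A)
  | put (a : A) (i j e : Exp R A)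
  | seq (p p' : Cmd R A)
  | ite (b : Test R A) (p p' : Cmd R A)
  | loop (b : Test R A) (p : Cmd R A)

/-- Contents of the registers and of the arrays. -/
structure Memory (R A : Type) : Type where
  reg : R → ℕ
  arr : A → ℕ → ℕ → ℕ

variable {R A : Type}

/-- The value of an expression. -/
def Exp.eval (σ : Memory R A) : Exp R A → ℕ
  | .lit k => k
  | .reg x => σ.reg x
  | .cell a i j => σ.arr a (i.eval σ) (j.eval σ)
  | .add e f => e.eval σ + f.eval σ
  | .sub e f => e.eval σ - f.eval σ
  | .half e => e.eval σ / 2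

/-- The outcome of a test. -/
def Test.eval (σ : Memory R A) : Test R A → Bool
  | .le e f => decide (e.eval σ ≤ f.eval σ)
  | .lt e f => decide (e.eval σ < f.eval σ)
  | .eq e f => decide (e.eval σ = f.eval σ)
  | .and b b' => b.eval σ && b'.eval σ
  | .not b => !b.eval σ

/-- Execute the commands of a list one after the other. -/
def block : List (Cmd R A) → Cmd R A
  | [] => .skip
  | p :: l => .seq p (block l)

/-- `if b then l`. -/
def when (b : Test R A) (l : List (Cmd R A)) : Cmd R A :=
  .ite b (block l) .skip

/-- `for x = 0, 1, …, e - 1 do l`. -/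
def forTo (x : R) (e : Exp R A) (l : List (Cmd R A)) : Cmd R A :=
  .seq (.set x (.lit 0))
    (.loop (.lt (.reg x) e) (.seq (block l) (.set x (.add (.reg x) (.lit 1)))))

/-- One-dimensional arrays are stored in row `0`. -/
def Exp.vec (a : A) (i : Exp R A) : Exp R A := .cell a (.lit 0) i

/-- Assignment to a one-dimensional array. -/
def Cmd.putVec (a : A) (i e : Exp R A) : Cmd R A := .put a (.lit 0) i e

instance : Coe R (Exp R A) := ⟨Exp.reg⟩

instance (k : ℕ) : OfNat (Exp R A) k := ⟨Exp.lit k⟩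

variable [DecidableEq R] [DecidableEq A]

/-- Write `k` into the register `x`. -/
def Memory.setReg (σ : Memory R A) (x : R) (k : ℕ) : Memory R A :=
  { σ with reg := Function.update σ.reg x k }

/-- Write `k` into the array cell `a[i][j]`. -/
def Memory.setCell (σ : Memory R A) (a : A) (i j k : ℕ) : Memory R A :=
  { σ with arr :=
      Function.update σ.arr a (Function.update (σ.arr a) i (Function.update (σ.arr a i) j k)) }

/-- One machine step. A configuration consists of the stack of commands that are still to be
executed and of the memory. `loop b p` is the loop "while `b` do `p`". -/
def step : List (Cmd R A) × Memory R A → List (Cmd R A) × Memory R A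
  | ([], σ) => ([], σ)
  | (.skip :: s, σ) => (s, σ)
  | (.set x e :: s, σ) => (s, σ.setReg x (e.eval σ))
  | (.put a i j e :: s, σ) => (s, σ.setCell a (i.eval σ) (j.eval σ) (e.eval σ))
  | (.seq p p' :: s, σ) => (p :: p' :: s, σ)
  | (.ite b p p' :: s, σ) => ((if b.eval σ then p else p') :: s, σ)
  | (.loop b p :: s, σ) => if b.eval σ then (p :: .loop b p :: s, σ) else (s, σ)

/-- Started in memory `σ`, the program `p` has halted after `t` steps with memory `σ'`. -/
def HaltsIn (p : Cmd R A) (σ : Memory R A) (t : ℕ) (σ' : Memory R A) : Prop :=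
  step^[t] ([p], σ) = ([], σ')

end Machine

/-! ## The tree coloring algorithm -/

/-- Registers: `n` is the number of vertices, `Delta` the maximum degree, `m` the best bound found
so far, `root` the current root, `l`, `u` the current search interval, `c` the current candidate,
`ok` is `1` as long as the current candidate has not failed, `stored` is `1` if a coloring has been
stored for the current root, `color` is the last color used. The others are auxiliary. -/
inductive Reg : Type
  | n | Delta | m | root | l | u | c | ok | stored | color
  | d | v | count | total | size | i | j | k | w | x | y
  deriving DecidableEq

/-- Arrays: `adj` is the adjacency matrix, `label` holds the distance from the root plus one
(`0` if not yet known), `res` the residual numbers, `cur` the current coloring (`0` stands for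
uncolored), `U` the last successful coloring for the current root, `M` the best coloring, `child`
lists the children of the current vertex, `opt` is the dynamic programming table of the knapsack
problem, and `mark` marks vertices. -/
inductive Arr : Type
  | adj | label | res | cur | U | M | child | opt | mark
  deriving DecidableEq

section Algorithm

open Reg Arr Exp Test Cmd

local infixl:65 "∔" => Exp.add
local infixl:65 "∸" => Exp.sub
local infix:50 "≼'" => Test.le
local infix:50 "≺'" => Test.lt
local infix:50 "≐'" => Test.eq
local infixr:35 "⩓" => Test.and
local infix:30 "≔" => Cmd.set

/-- Compute the maximum degree. -/
def maxDegree : Cmd Reg Arr :=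
  block [
    Delta ≔ 0,
    forTo x n [
      k ≔ 0,
      forTo y n [when (cell adj x y ≐' 1) [k ≔ k ∔ 1]],
      when (Delta ≺' k) [Delta ≔ k]]]

/-- Label each vertex with its distance from the root (plus one), by breadth-first search. -/
def labelVertices : Cmd Reg Arr :=
  block [
    forTo x n [putVec label x 0],
    putVec label root 1,
    forTo d n [
      forTo x n [
        when (vec label x ≐' d ∔ 1) [
          forTo y n [
            when (cell adj x y ≐' 1 ⩓ vec label y ≐' 0) [putVec label y (d ∔ 2)]]]]]]

/-- List the children of `v`, where `d` is the label of `v`, and add up their residual numbers. -/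
def listChildren : Cmd Reg Arr :=
  block [
    count ≔ 0,
    total ≔ 0,
    forTo w n [
      when (cell adj v w ≐' 1 ⩓ vec label w ≐' d ∔ 1) [
        putVec child count w,
        total ≔ total ∔ vec res w,
        count ≔ count ∔ 1]]]

/-- Solve the knapsack instance with capacity `c` whose items are the children of `v`, their sizes
(and values) being their residual numbers: `opt[i][w]` is the largest total size, at most `w`, of a
set of items among the first `i` ones. -/
def solveKnapsack : Cmd Reg Arr :=
  block [
    forTo w (c ∔ 1) [put opt 0 w 0],
    forTo i count [
      size ≔ vec res (vec child i),
      forTo w (c ∔ 1) [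
        put opt (i ∔ 1) w (cell opt i w),
        when (size ≼' w ⩓ cell opt i w ≺' cell opt i (w ∸ size) ∔ size) [
          put opt (i ∔ 1) w (cell opt i (w ∸ size) ∔ size)]]]]

/-- Read off an optimal set of children from the table, and mark these children. -/
def markSolution : Cmd Reg Arr :=
  block [
    forTo x n [putVec mark x 0],
    w ≔ c,
    forTo j count [
      i ≔ count ∸ (j ∔ 1),
      when (cell opt i w ≺' cell opt (i ∔ 1) w) [
        putVec mark (vec child i) 1,
        w ≔ w ∸ vec res (vec child i)]]]

/-- Mark all successors of the marked vertices. -/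
def markSuccessors : Cmd Reg Arr :=
  forTo j n [
    forTo x n [
      when (vec label x ≐' j ⩓ vec mark x ≐' 1) [
        forTo y n [
          when (cell adj x y ≐' 1 ⩓ vec label y ≐' j ∔ 1) [putVec mark y 1]]]]]

/-- Color the uncolored edges incident to marked vertices with a new color. -/
def colorMarked : Cmd Reg Arr :=
  block [
    color ≔ color ∔ 1,
    forTo x n [
      when (vec mark x ≐' 1) [
        forTo y n [
          when (cell adj x y ≐' 1 ⩓ cell cur x y ≐' 0) [
            put cur x y color,
            put cur y x color]]]]]

/-- Treat the vertex `v`, whose label is `d`, unless it has no children. -/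
def processVertex : Cmd Reg Arr :=
  block [
    listChildren,
    when (0 ≺' count) [
      solveKnapsack,
      .ite (c ≺' (total ∸ cell opt count c) ∔ vec res v)
        (ok ≔ 0)
        (block [
          markSolution,
          markSuccessors,
          colorMarked,
          putVec res v (vec res v ∔ (total ∸ cell opt count c))])]]

/-- Color the remaining uncolored edges with one new color. -/
def colorRemaining : Cmd Reg Arr :=
  block [
    color ≔ color ∔ 1,
    forTo x n [
      forTo y n [
        when (cell adj x y ≐' 1 ⩓ cell cur x y ≐' 0) [put cur x y color]]]]

/-- Copy the coloring `a` to `b`. -/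
def copyColoring (a b : Arr) : Cmd Reg Arr :=
  forTo x n [forTo y n [put b x y (cell a x y)]]

/-- Test the candidate `c = ⌊(l + u) / 2⌋`, going through the vertices in descending order of
distance from the root, and update the search interval. -/
def testCandidate : Cmd Reg Arr :=
  block [
    forTo x n [putVec res x 1],
    putVec res root 0,
    c ≔ half (l ∔ u),
    forTo x n [forTo y n [put cur x y 0]],
    color ≔ 0,
    ok ≔ 1,
    forTo k n [
      d ≔ n ∸ k,
      forTo v n [
        when (vec label v ≐' d ⩓ ok ≐' 1) [processVertex]]],
    .ite (ok ≐' 1)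
      (block [colorRemaining, copyColoring cur U, u ≔ c, stored ≔ 1])
      (l ≔ c ∔ 1)]

/-- The whole algorithm. A tree with at most one edge is treated separately. -/
def treeColoring : Cmd Reg Arr :=
  block [
    maxDegree,
    .ite (Delta ≼' 1)
      (block [
        m ≔ Delta,
        forTo x n [forTo y n [put M x y 1]]])
      (block [
        m ≔ Delta ∸ 1,
        forTo root n [
          labelVertices,
          l ≔ half (Delta ∔ 1),
          u ≔ Delta ∸ 1,
          stored ≔ 0,
          .loop (.not (l ≐' u ⩓ stored ≐' 1)) testCandidate,
          when (u ≼' m) [m ≔ u, copyColoring U M]]])]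

end Algorithm

/-- The initial memory: the register `n` holds the number of vertices, the array `adj` the
adjacency matrix, and everything else is zero. -/
def input {n : ℕ} (G : SimpleGraph (Fin n)) [DecidableRel G.Adj] : Memory Reg Arr where
  reg := Function.update (fun _ => 0) Reg.n n
  arr := Function.update (fun _ _ _ => 0) Arr.adj fun i j =>
    if h : i < n ∧ j < n then (if G.Adj ⟨i, h.1⟩ ⟨j, h.2⟩ then 1 else 0) else 0

end MinMaxColoring

/-! Root the tree at `r` and let every other vertex carry the color of the edge to its parent. An
edge 2-coloring becomes a function `f` on vertices for which the children of each `v` use at most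
one color besides `f v`; the value `f r` is free and serves as one of the two colors at the root.
The color groups are the fibers of `f` with `r` removed (`Valid`).

For a fixed bound `c` the greedy test is exact. Lower bound (`Rooted.residual_le`): in every
solution, at least as many edges of color `f v` as the residual number of `v` lie in the subtree of
`v`, the edge to its parent included. Indeed, the children colored differently from `v` share one
color and have disjoint subtrees, so inductively their residual numbers sum to at most `c`, hence to
at most the knapsack optimum; all other children contribute to the color `f v`. A residual number
above `c` therefore refutes every solution. Upper bound (`Partial.treat`, `Partial.valid`): as long
as the test succeeds, the residual number of a treated, still uncolored vertex is exactly the number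
of uncolored edges in its subtree, so each new group has size at most `c`, and the last group is
counted by the residual number of the root.

Solvability for `c` is monotone in `c` and independent of the root, so bisection finds the optimum
from every root. The initial interval is correct: two groups must cover the edges at a vertex of
maximum degree Δ (`Rooted.degree_le_two_mul`), and for Δ ≥ 2 there is an explicit solution for Δ - 1
(`Rooted.exists_valid`).

The program is verified in a calculus of total correctness, `Wp`, which also counts steps: if no
loop exceeds `N` iterations, the running time is at most the polynomial `cost`, read off from the
syntax, at `N`. Here `N = n` suffices, because `c + 1 ≤ Δ ≤ n` and the bisection needs at most `u -
l + 1` rounds. -/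

namespace MinMaxColoring

/-! ### A program logic for total correctness with step bounds -/

section Logic

set_option linter.unusedSectionVars false

variable {R A : Type} [DecidableEq R] [DecidableEq A]

/-- The command `p` turns the memory `σ` into `σ'` in `t` steps, whatever comes after it. -/
def Runs (p : Cmd R A) (σ : Memory R A) (t : ℕ) (σ' : Memory R A) : Prop :=
  ∀ s, step^[t] (p :: s, σ) = (s, σ')

/-- A bound for the number of steps of a program all of whose loops are iterated at most `X`
times. -/
noncomputable def cost : Cmd R A → Polynomial ℕ
  | .skip => 1
  | .set _ _ => 1
  | .put _ _ _ _ => 1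
  | .seq p q => 1 + cost p + cost q
  | .ite _ p q => 1 + cost p + cost q
  | .loop _ p => Polynomial.X * (1 + cost p) + 1

/-- The program contains an assignment to the register `x`. -/
def Cmd.setsReg (x : R) : Cmd R A → Bool
  | .skip => false
  | .set y _ => decide (y = x)
  | .put _ _ _ _ => false
  | .seq p q => p.setsReg x || q.setsReg x
  | .ite _ p q => p.setsReg x || q.setsReg x
  | .loop _ p => p.setsReg x

/-- The program contains an assignment to a cell of the array `a`. -/
def Cmd.setsArr (a : A) : Cmd R A → Bool
  | .skip => false
  | .set _ _ => false
  | .put b _ _ _ => decide (b = a)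
  | .seq p q => p.setsArr a || q.setsArr a
  | .ite _ p q => p.setsArr a || q.setsArr a
  | .loop _ p => p.setsArr a

/-- The memories differ only in places the program may write to. -/
structure Frame (p : Cmd R A) (σ σ' : Memory R A) : Prop where
  reg : ∀ x, p.setsReg x = false → σ'.reg x = σ.reg x
  arr : ∀ a, p.setsArr a = false → σ'.arr a = σ.arr a

theorem Frame.refl (p : Cmd R A) (σ : Memory R A) : Frame p σ σ := ⟨fun _ _ => rfl, fun _ _ => rfl⟩

theorem Frame.trans {p : Cmd R A} {σ σ' σ'' : Memory R A} (h : Frame p σ σ')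
    (h' : Frame p σ' σ'') : Frame p σ σ'' :=
  ⟨fun x hx => (h'.reg x hx).trans (h.reg x hx), fun a ha => (h'.arr a ha).trans (h.arr a ha)⟩

theorem Frame.weaken {p q : Cmd R A} {σ σ' : Memory R A} (h : Frame p σ σ')
    (hr : ∀ x, q.setsReg x = false → p.setsReg x = false)
    (ha : ∀ a, q.setsArr a = false → p.setsArr a = false) : Frame q σ σ' :=
  ⟨fun x hx => h.reg x (hr x hx), fun a h' => h.arr a (ha a h')⟩

@[simp] theorem Memory.setReg_arr (σ : Memory R A) (x : R) (k : ℕ) :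
    (σ.setReg x k).arr = σ.arr := rfl

@[simp] theorem Memory.setCell_reg (σ : Memory R A) (a : A) (i j k : ℕ) :
    (σ.setCell a i j k).reg = σ.reg := rfl

theorem Memory.setReg_reg (σ : Memory R A) (x : R) (k : ℕ) (y : R) :
    (σ.setReg x k).reg y = if y = x then k else σ.reg y := by
  simp [Memory.setReg, Function.update_apply]

theorem Memory.setCell_arr (σ : Memory R A) (a : A) (i j k : ℕ) (b : A) (i' j' : ℕ) :
    (σ.setCell a i j k).arr b i' j' =
      if b = a ∧ i' = i ∧ j' = j then k else σ.arr b i' j' := by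
  simp only [Memory.setCell, Function.update_apply]
  by_cases hb : b = a
  · subst hb
    by_cases hi : i' = i
    · subst hi
      by_cases hj : j' = j <;> simp [hj]
    · simp [hi]
  · simp [hb]

theorem Memory.setCell_arr_ne (σ : Memory R A) (a : A) (i j k : ℕ) (b : A) (h : b ≠ a) :
    (σ.setCell a i j k).arr b = σ.arr b := by
  simp [Memory.setCell, h]

/-- Started in `σ`, the program halts in a memory that satisfies `Q`, within the time that is
allowed by `cost` for loops of length at most `N`. -/
def Wp (N : ℕ) (p : Cmd R A) (Q : Memory R A → Prop) (σ : Memory R A) : Prop :=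
  ∃ t ≤ (cost p).eval N, ∃ σ', Runs p σ t σ' ∧ Frame p σ σ' ∧ Q σ'

variable {N : ℕ} {p q : Cmd R A} {Q Q' : Memory R A → Prop} {σ : Memory R A}

/-- The frame is handed on to the continuation, so postconditions need only mention what a
subprogram changes. -/
theorem Wp.mono (h : Wp N p Q σ) (hQ : ∀ σ', Frame p σ σ' → Q σ' → Q' σ') : Wp N p Q' σ := by
  obtain ⟨t, ht, σ', hr, hf, hq⟩ := h
  exact ⟨t, ht, σ', hr, hf, hQ σ' hf hq⟩

theorem wp_skip (h : Q σ) : Wp N .skip Q σ :=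
  ⟨1, by simp [cost], σ, fun _ => rfl, .refl _ _, h⟩

theorem wp_set {x : R} {e : Exp R A} (h : Q (σ.setReg x (e.eval σ))) : Wp N (.set x e) Q σ := by
  refine ⟨1, by simp [cost], _, fun _ => rfl, ⟨fun y hy => ?_, fun _ _ => rfl⟩, h⟩
  have : y ≠ x := by rintro rfl; simp [Cmd.setsReg] at hy
  simp [Memory.setReg_reg, this]

theorem wp_put {a : A} {i j e : Exp R A}
    (h : Q (σ.setCell a (i.eval σ) (j.eval σ) (e.eval σ))) : Wp N (.put a i j e) Q σ := by
  refine ⟨1, by simp [cost], _, fun _ => rfl, ⟨fun _ _ => rfl, fun b hb => ?_⟩, h⟩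
  have : b ≠ a := by rintro rfl; simp [Cmd.setsArr] at hb
  exact Memory.setCell_arr_ne _ _ _ _ _ _ this

theorem Runs.seq {σ' σ'' : Memory R A} {t t' : ℕ} (h : Runs p σ t σ') (h' : Runs q σ' t' σ'') :
    Runs (.seq p q) σ (t' + t + 1) σ'' := by
  intro s
  rw [Function.iterate_succ_apply, Function.iterate_add_apply]
  show step^[t'] (step^[t] (p :: q :: s, σ)) = _
  rw [h, h']

theorem wp_seq (h : Wp N p (fun σ' => Wp N q Q σ') σ) : Wp N (.seq p q) Q σ := by
  obtain ⟨t, ht, σ', hr, hf, t', ht', σ'', hr', hf', hq⟩ := h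
  refine ⟨_, ?_, σ'', hr.seq hr', ?_, hq⟩
  · simp only [cost, Polynomial.eval_add, Polynomial.eval_one]; omega
  · refine (hf.weaken ?_ ?_).trans (hf'.weaken ?_ ?_) <;>
      simp +contextual [Cmd.setsReg, Cmd.setsArr]

theorem wp_ite {b : Test R A} (h : b.eval σ = true → Wp N p Q σ)
    (h' : b.eval σ = false → Wp N q Q σ) : Wp N (.ite b p q) Q σ := by
  rcases hb : b.eval σ with _ | _
  · obtain ⟨t, ht, σ', hr, hf, hq⟩ := h' hb
    refine ⟨t + 1, ?_, σ', fun s => ?_, ?_, hq⟩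
    · simp only [cost, Polynomial.eval_add, Polynomial.eval_one]; omega
    · rw [Function.iterate_succ_apply]
      simpa [step, hb] using hr s
    · refine hf.weaken ?_ ?_ <;> simp +contextual [Cmd.setsReg, Cmd.setsArr]
  · obtain ⟨t, ht, σ', hr, hf, hq⟩ := h hb
    refine ⟨t + 1, ?_, σ', fun s => ?_, ?_, hq⟩
    · simp only [cost, Polynomial.eval_add, Polynomial.eval_one]; omega
    · rw [Function.iterate_succ_apply]
      simpa [step, hb] using hr s
    · refine hf.weaken ?_ ?_ <;> simp +contextual [Cmd.setsReg, Cmd.setsArr]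

/-- Strong induction on the variant `k`. The current memory `σ₁` varies while the frame refers to
the initial `σ`, so invariants may speak about the initial memory. Each iteration pays one step for
its test, and the failing test pays the final one. -/
theorem wp_loop_aux {b : Test R A} (I : ℕ → Memory R A → Prop)
    (hs : ∀ k σ', Frame p σ σ' → I k σ' → b.eval σ' = true →
      0 < k ∧ Wp N p (fun σ'' => ∃ j < k, I j σ'') σ')
    (hQ : ∀ k σ', Frame p σ σ' → I k σ' → b.eval σ' = false → Q σ') (k : ℕ) :
    ∀ σ₁, Frame p σ σ₁ → I k σ₁ →
      ∃ t ≤ k * (1 + (cost p).eval N) + 1, ∃ σ', Runs (.loop b p) σ₁ t σ' ∧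
        Frame p σ σ' ∧ Q σ' := by
  induction k using Nat.strong_induction_on with
  | _ k ih =>
    intro σ₁ hf hI
    rcases hb : b.eval σ₁ with _ | _
    · exact ⟨1, by omega, σ₁, fun s => by simp [step, hb], hf, hQ k σ₁ hf hI hb⟩
    · obtain ⟨hk, t, ht, σ₂, hr, hf₂, j, hj, hI₂⟩ := hs k σ₁ hf hI hb
      obtain ⟨t', ht', σ₃, hr', hf₃, hq⟩ := ih j hj σ₂ (hf.trans hf₂) hI₂
      refine ⟨t' + t + 1, ?_, σ₃, fun s => ?_, hf₃, hq⟩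
      · have : (j + 1) * (1 + (cost p).eval N) ≤ k * (1 + (cost p).eval N) :=
          Nat.mul_le_mul_right _ hj
        rw [Nat.add_mul] at this
        omega
      · rw [Function.iterate_succ_apply, Function.iterate_add_apply]
        simp only [step, hb, if_true]
        rw [hr, hr']

/-- While-loops: `k` in `I k` bounds the number of iterations that are left. -/
theorem wp_loop {b : Test R A} (I : ℕ → Memory R A → Prop) (K : ℕ) (hK : K ≤ N) (h0 : I K σ)
    (hs : ∀ k σ', Frame p σ σ' → I k σ' → b.eval σ' = true →
      0 < k ∧ Wp N p (fun σ'' => ∃ j < k, I j σ'') σ')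
    (hQ : ∀ k σ', Frame p σ σ' → I k σ' → b.eval σ' = false → Q σ') :
    Wp N (.loop b p) Q σ := by
  obtain ⟨t, ht, σ', hr, hf, hq⟩ := wp_loop_aux I hs hQ K σ (.refl _ _) h0
  refine ⟨t, ht.trans ?_, σ', hr, ⟨hf.reg, hf.arr⟩, hq⟩
  simp only [cost, Polynomial.eval_add, Polynomial.eval_one, Polynomial.eval_mul,
    Polynomial.eval_X]
  gcongr

theorem wp_block_nil (h : Q σ) : Wp N (block []) Q σ := wp_skip h

theorem wp_block_cons {l : List (Cmd R A)} (h : Wp N p (fun σ' => Wp N (block l) Q σ') σ) :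
    Wp N (block (p :: l)) Q σ := wp_seq h

theorem wp_when {b : Test R A} {l : List (Cmd R A)}
    (h : b.eval σ = true → Wp N (block l) Q σ) (h' : b.eval σ = false → Q σ) :
    Wp N (when b l) Q σ :=
  wp_ite h fun hb => wp_skip (h' hb)

/-- For-loops with the invariant `I`. -/
theorem wp_forTo {x : R} {e : Exp R A} {l : List (Cmd R A)} (I : ℕ → Memory R A → Prop) (E : ℕ)
    (hE : E ≤ N) (hx : (block l).setsReg x = false) (h0 : I 0 (σ.setReg x 0))
    (he : ∀ k σ', Frame (forTo x e l) σ σ' → I k σ' → e.eval σ' = E)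
    (hs : ∀ k < E, ∀ σ', Frame (forTo x e l) σ σ' → σ'.reg x = k → I k σ' →
      Wp N (block l) (fun σ'' => I (k + 1) (σ''.setReg x (k + 1))) σ')
    (hQ : ∀ σ', Frame (forTo x e l) σ σ' → I E σ' → Q σ') :
    Wp N (forTo x e l) Q σ := by
  refine wp_seq (wp_set ?_)
  -- The inner loop is framed relative to the memory after `x` was reset; this converts to the frame
  -- of the whole for-loop.
  have hw : ∀ σ', Frame (.seq (block l) (.set x (.add (.reg x) (.lit 1))))
      (σ.setReg x 0) σ' → Frame (forTo x e l) σ σ' := by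
    intro σ' hf
    refine Frame.trans (σ' := σ.setReg x 0) ⟨fun y hy => ?_, fun _ _ => rfl⟩ (hf.weaken ?_ ?_)
    · have : y ≠ x := by rintro rfl; simp [forTo, Cmd.setsReg] at hy
      simp [Memory.setReg_reg, this]
    · simp +contextual [forTo, Cmd.setsReg]
    · simp +contextual [forTo, Cmd.setsArr]
  -- The counter register itself indexes the invariant; the variant is the number of rounds left.
  refine wp_loop (fun j σ' => j = E - σ'.reg x ∧ σ'.reg x ≤ E ∧ I (σ'.reg x) σ') E hE ?_ ?_ ?_
  · simp only [Exp.eval, Memory.setReg_reg, if_true]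
    exact ⟨by omega, by omega, h0⟩
  · rintro j σ' hf ⟨hj, hle, hI⟩ hb
    have hlt : σ'.reg x < E := by
      simpa [Test.eval, Exp.eval, he _ σ' (hw _ hf) hI] using hb
    refine ⟨by omega, wp_seq ((hs _ hlt σ' (hw _ hf) rfl hI).mono fun σ'' hf' hI' => wp_set ?_)⟩
    have hr : σ''.reg x = σ'.reg x := hf'.reg x hx
    simp only [Exp.eval, hr, Memory.setReg_reg, if_true]
    exact ⟨E - (σ'.reg x + 1), by omega, rfl, by omega, hI'⟩
  · rintro j σ' hf ⟨hj, hle, hI⟩ hb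
    have hge : E ≤ σ'.reg x := by
      simpa [Test.eval, Exp.eval, he _ σ' (hw _ hf) hI] using hb
    have heq : σ'.reg x = E := by omega
    exact hQ σ' (hw _ hf) (heq ▸ hI)

theorem Wp.haltsIn (h : Wp N p Q σ) : ∃ t ≤ (cost p).eval N, ∃ σ', HaltsIn p σ t σ' ∧ Q σ' := by
  obtain ⟨t, ht, σ', hr, -, hq⟩ := h
  exact ⟨t, ht, σ', hr [], hq⟩

end Logic

end MinMaxColoring

namespace MinMaxColoring

/-! ### Rooted trees and the combinatorics of the greedy test -/

section RootedTrees

open Finset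

/-- The array `a` is the adjacency matrix of a tree on `0, …, n - 1` with root `r`, in which `par`
gives the parents and `dep` the distances from the root. -/
structure Rooted (n : ℕ) (a : ℕ → ℕ → ℕ) (r : ℕ) (par dep : ℕ → ℕ) : Prop where
  root_lt : r < n
  dep_root : dep r = 0
  par_lt : ∀ x < n, x ≠ r → par x < n
  dep_par : ∀ x < n, x ≠ r → dep x = dep (par x) + 1
  dep_lt : ∀ x < n, dep x < n
  adj_iff : ∀ x < n, ∀ y < n, a x y = 1 ↔ (x ≠ r ∧ par x = y) ∨ (y ≠ r ∧ par y = x)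

/-- `Below n r par Z x`: the vertex `x` is in `Z` or is a descendant of a vertex in `Z`. -/
inductive Below (n r : ℕ) (par : ℕ → ℕ) (Z : Set ℕ) : ℕ → Prop
  | base {x : ℕ} (hn : x < n) (h : x ∈ Z) : Below n r par Z x
  | step {x : ℕ} (hn : x < n) (hr : x ≠ r) (h : Below n r par Z (par x)) : Below n r par Z x

/-- The children of `v`. -/
def children (n r : ℕ) (par : ℕ → ℕ) (v : ℕ) : Finset ℕ :=
  {w ∈ range n | w ≠ r ∧ par w = v}

/-- The vertices of color `k` below `v`, except the root, where the color of a vertex is that of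
the edge to its parent. -/
noncomputable def colored (n r : ℕ) (par : ℕ → ℕ) (f : ℕ → ℕ) (k v : ℕ) : Finset ℕ :=
  open Classical in {w ∈ range n | w ≠ r ∧ f w = k ∧ Below n r par {v} w}

/-- The coloring `f` of the vertices is, read as an edge coloring, a feasible solution all of whose
color groups have size at most `c`. -/
structure Valid (n r : ℕ) (par : ℕ → ℕ) (c : ℕ) (f : ℕ → ℕ) : Prop where
  two : ∀ v < n, ∃ K, ∀ w ∈ children n r par v, f w = K ∨ f w = f v
  group : ∀ k, #{x ∈ range n | x ≠ r ∧ f x = k} ≤ c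

variable {n r c : ℕ} {a : ℕ → ℕ → ℕ} {par dep : ℕ → ℕ}

theorem mem_children {v w : ℕ} : w ∈ children n r par v ↔ w < n ∧ w ≠ r ∧ par w = v := by
  simp [children]

theorem below_iff {Z : Set ℕ} {x : ℕ} (hx : x < n) :
    Below n r par Z x ↔ x ∈ Z ∨ (x ≠ r ∧ Below n r par Z (par x)) := by
  constructor
  · rintro (⟨_, h⟩ | ⟨_, h, h'⟩)
    · exact .inl h
    · exact .inr ⟨h, h'⟩
  · rintro (h | ⟨h, h'⟩)
    · exact .base hx h
    · exact .step hx h h'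

theorem Below.exists_mem {Z : Set ℕ} {x : ℕ} (h : Below n r par Z x) :
    ∃ z ∈ Z, z < n ∧ Below n r par {z} x := by
  induction h with
  | base hn h => exact ⟨_, h, hn, .base hn rfl⟩
  | step hn hr _ ih =>
    obtain ⟨z, hz, hzn, h⟩ := ih
    exact ⟨z, hz, hzn, .step hn hr h⟩

theorem Below.mono {Z Z' : Set ℕ} (hZ : Z ⊆ Z') {x : ℕ} (h : Below n r par Z x) :
    Below n r par Z' x := by
  induction h with
  | base hn h => exact .base hn (hZ h)
  | step hn hr _ ih => exact .step hn hr ih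

theorem Below.trans {Z : Set ℕ} {x y : ℕ} (h : Below n r par Z x) (h' : Below n r par {x} y) :
    Below n r par Z y := by
  induction h' with
  | base hn h => simpa [Set.mem_singleton_iff.1 h] using ‹Below n r par Z x›
  | step hn hr _ ih => exact .step hn hr ih

theorem Rooted.dep_le_of_below (hT : Rooted n a r par dep) {v x : ℕ}
    (h : Below n r par {v} x) : dep v ≤ dep x := by
  induction h with
  | base hn h => rw [Set.mem_singleton_iff.1 h]
  | step hn hr _ ih => rw [hT.dep_par _ hn hr]; omega

/-- Each step towards the root lowers the depth by one, so an ancestor of `x` is determined by its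
depth. In particular, distinct siblings have disjoint subtrees. -/
theorem Rooted.eq_of_below (hT : Rooted n a r par dep) {u v x : ℕ}
    (h : Below n r par {u} x) (h' : Below n r par {v} x) (hd : dep u = dep v) : u = v := by
  induction h with
  | @base x hn h =>
    rw [Set.mem_singleton_iff] at h
    subst h
    rcases (below_iff hn).1 h' with h | ⟨hr, h⟩
    · exact h
    · have := hT.dep_le_of_below h
      have := hT.dep_par _ hn hr
      omega
  | @step x hn hr hb ih =>
    rcases (below_iff hn).1 h' with h | ⟨_, h⟩
    · have := hT.dep_le_of_below hb
      have := hT.dep_par _ hn hr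
      rw [Set.mem_singleton_iff] at h
      subst h
      omega
    · exact ih h

theorem Rooted.below_root (hT : Rooted n a r par dep) {x : ℕ} (hx : x < n) :
    Below n r par {r} x := by
  induction hd : dep x using Nat.strong_induction_on generalizing x with
  | _ d ih =>
    by_cases h : x = r
    · exact .base hx h
    · have := hT.dep_par x hx h
      exact .step hx h (ih _ (by omega) (hT.par_lt x hx h) rfl)

theorem below_singleton_iff {v x : ℕ} (hv : v < n) :
    Below n r par {v} x ↔ x = v ∨ ∃ w ∈ children n r par v, Below n r par {w} x := by
  constructor
  · intro h
    induction h with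
    | base hn h => exact .inl h
    | @step x hn hr hb ih =>
      rcases ih with h | ⟨w, hw, h⟩
      · exact .inr ⟨x, mem_children.2 ⟨hn, hr, h⟩, .base hn rfl⟩
      · exact .inr ⟨w, hw, .step hn hr h⟩
  · rintro (rfl | ⟨w, hw, h⟩)
    · exact .base hv rfl
    · obtain ⟨hwn, hwr, rfl⟩ := mem_children.1 hw
      exact (Below.step hwn hwr (.base hv (Set.mem_singleton _))).trans h

theorem Rooted.dep_child (hT : Rooted n a r par dep) {v w : ℕ} (hw : w ∈ children n r par v) :
    dep w = dep v + 1 := by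
  obtain ⟨hwn, hwr, rfl⟩ := mem_children.1 hw
  exact hT.dep_par w hwn hwr

theorem mem_colored {f : ℕ → ℕ} {k v w : ℕ} : w ∈ colored n r par f k v ↔
    w < n ∧ w ≠ r ∧ f w = k ∧ Below n r par {v} w := by
  simp [colored]

theorem Rooted.sum_colored (hT : Rooted n a r par dep) (f : ℕ → ℕ) (k v : ℕ) (S : Finset ℕ)
    (hS : S ⊆ children n r par v) :
    ∑ w ∈ S, #(colored n r par f k w) = #(S.biUnion (colored n r par f k)) := by
  refine (card_biUnion fun w hw w' hw' hne => disjoint_left.2 fun x hx hx' => hne ?_).symm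
  have h₁ := hT.dep_child (hS hw)
  have h₂ := hT.dep_child (hS hw')
  exact hT.eq_of_below (mem_colored.1 hx).2.2.2 (mem_colored.1 hx').2.2.2 (by omega)

/-- The subtree of `v` splits into `v` and the disjoint subtrees of its children. The first summand
stands for the edge from `v` to its parent, which the root lacks. -/
theorem Rooted.card_colored (hT : Rooted n a r par dep) (f : ℕ → ℕ) {k v : ℕ} (hv : v < n) :
    #(colored n r par f k v) = (if v ≠ r ∧ f v = k then 1 else 0) +
      ∑ w ∈ children n r par v, #(colored n r par f k w) := by
  rw [hT.sum_colored f k v _ subset_rfl]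
  have hd : ∀ x ∈ (children n r par v).biUnion (colored n r par f k), x ≠ v := by
    intro x hx
    obtain ⟨w, hw, h⟩ := mem_biUnion.1 hx
    have h₁ := hT.dep_child hw
    have h₂ := hT.dep_le_of_below (mem_colored.1 h).2.2.2
    rintro rfl
    omega
  split_ifs with h
  · rw [add_comm, ← card_insert_of_notMem (a := v) fun hv' => hd v hv' rfl]
    congr 1
    ext x
    simp only [mem_colored, mem_insert, mem_biUnion, below_singleton_iff hv]
    constructor
    · rintro ⟨hx, hxr, hf, rfl | ⟨w, hw, hb⟩⟩
      · exact .inl rfl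
      · exact .inr ⟨w, hw, hx, hxr, hf, hb⟩
    · rintro (rfl | ⟨w, hw, hx, hxr, hf, hb⟩)
      · exact ⟨hv, h.1, h.2, .inl rfl⟩
      · exact ⟨hx, hxr, hf, .inr ⟨w, hw, hb⟩⟩
  · rw [zero_add]
    congr 1
    ext x
    simp only [mem_colored, mem_biUnion, below_singleton_iff hv]
    constructor
    · rintro ⟨hx, hxr, hf, rfl | ⟨w, hw, hb⟩⟩
      · exact absurd ⟨hxr, hf⟩ h
      · exact ⟨w, hw, hx, hxr, hf, hb⟩
    · rintro ⟨w, hw, hx, hxr, hf, hb⟩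
      exact ⟨hx, hxr, hf, .inr ⟨w, hw, hb⟩⟩

/-! ### Every test candidate that admits a solution passes -/

theorem colored_subset (f : ℕ → ℕ) (k v : ℕ) :
    colored n r par f k v ⊆ {x ∈ range n | x ≠ r ∧ f x = k} := by
  intro x hx
  obtain ⟨h₁, h₂, h₃, -⟩ := mem_colored.1 hx
  simp [*]

theorem Valid.card_colored_le {f : ℕ → ℕ} (hf : Valid n r par c f) (k v : ℕ) :
    #(colored n r par f k v) ≤ c :=
  (card_le_card (colored_subset f k v)).trans (hf.group k)

/-- Inductive step of the lower bound. The children not colored like `v` all have the color `K`,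
whose group has at most `c` edges, so their residual numbers form a knapsack solution and sum to at
most `B`. What exceeds `B` comes from children colored `f v`, whose subtrees contribute to the group
of `v`. -/
theorem Rooted.residual_le (hT : Rooted n a r par dep) {f : ℕ → ℕ} (hf : Valid n r par c f)
    {res : ℕ → ℕ} (hres : ∀ x < n, res x ≤ #(colored n r par f (f x) x)) {v B : ℕ} (hv : v < n)
    (hv' : res v = if v = r then 0 else 1)
    (hB : ∀ S ⊆ children n r par v, ∑ w ∈ S, res w ≤ c → ∑ w ∈ S, res w ≤ B) :
    (∑ w ∈ children n r par v, res w - B) + res v ≤ #(colored n r par f (f v) v) := by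
  obtain ⟨K, hK⟩ := hf.two v hv
  have hlt : ∀ w ∈ children n r par v, w < n := fun w hw => (mem_children.1 hw).1
  have h₁ : ∑ w ∈ children n r par v with f w ≠ f v, res w ≤ c := by
    calc ∑ w ∈ children n r par v with f w ≠ f v, res w
        ≤ ∑ w ∈ children n r par v with f w ≠ f v, #(colored n r par f K w) := by
          refine sum_le_sum fun w hw => ?_
          rw [mem_filter] at hw
          have := (hK w hw.1).resolve_right hw.2
          exact this ▸ hres w (hlt w hw.1)
      _ ≤ c := by
          rw [hT.sum_colored f K v _ (filter_subset _ _)]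
          exact (card_le_card (biUnion_subset.2 fun w _ => colored_subset f K w)).trans
            (hf.group K)
  have h₂ := hB _ (filter_subset _ _) h₁
  have h₃ := sum_filter_add_sum_filter_not (children n r par v) (fun w => f w ≠ f v) res
  have h₄ : ∑ w ∈ children n r par v with ¬ f w ≠ f v, res w ≤
      ∑ w ∈ children n r par v, #(colored n r par f (f v) w) := by
    refine (sum_le_sum fun w hw => ?_).trans (sum_le_sum_of_subset (filter_subset _ _))
    rw [mem_filter, not_not] at hw
    exact hw.2 ▸ hres w (hlt w hw.1)
  have h₅ := hT.card_colored f (k := f v) hv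
  -- The extra one for the edge to the parent is absent on both sides when `v` is the root.
  by_cases hr : v = r
  · subst hr
    simp only [if_true, ne_eq, not_true_eq_false, false_and, if_false] at hv' h₅
    omega
  · simp only [hr, if_true, ne_eq, if_false, not_false_eq_true, true_and] at hv' h₅
    omega

/-! ### A passed test gives a solution -/

/-- The situation during a test, when the vertices in `P` have been treated: the residual numbers
are `res` and the colors `col`, where `0` stands for uncolored. -/
structure Partial (n r : ℕ) (par : ℕ → ℕ) (c : ℕ) (P : Set ℕ) (res col : ℕ → ℕ) : Prop where
  res_eq : ∀ x < n, x ∉ P → res x = if x = r then 0 else 1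
  res_le : ∀ x < n, res x ≤ c
  col_root : col r = 0
  uncolored : ∀ x < n, x ≠ r → par x ∉ P → col x = 0
  group : ∀ k ≠ 0, #{x ∈ range n | x ≠ r ∧ col x = k} ≤ c
  two : ∀ v < n, v ∈ P → ∃ K ≠ 0, ∀ w ∈ children n r par v, col w = K ∨ col w = col v
  card_uncolored : ∀ v < n, v ∈ P → col v = 0 → #(colored n r par col 0 v) = res v

/-- `P` is only required to contain no vertex, not to be empty: during the run it is given by a
condition on depths, which may hold for numbers outside the tree. -/
theorem Partial.start (hc : 1 ≤ c) {P : Set ℕ} (hP : ∀ x < n, x ∉ P) {res : ℕ → ℕ}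
    (hres : ∀ x < n, res x = if x = r then 0 else 1) :
    Partial n r par c P res (fun _ => 0) where
  res_eq x hx _ := hres x hx
  res_le x hx := by rw [hres x hx]; split_ifs <;> omega
  col_root := rfl
  uncolored _ _ _ _ := rfl
  group k hk := by simp [hk.symm]
  two v hv h := absurd h (hP v hv)
  card_uncolored v hv h := absurd h (hP v hv)

open Classical in
/-- The coloring after the uncolored edges at and below the vertices of `S` got color `K`. -/
noncomputable def recolor (n r : ℕ) (par : ℕ → ℕ) (col : ℕ → ℕ) (S : Set ℕ) (K x : ℕ) : ℕ :=
  if col x = 0 ∧ Below n r par S x then K else col x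

-- Inductive step of the upper bound. The new group consists of the uncolored edges at and below
-- `S`, which the residual numbers count exactly; these sum to at most `c`. Recoloring preserves
-- feasibility at older vertices because they lie at or below `S` together with all of their
-- children or with none. At `v` itself the children in `S` get `K` and the others stay uncolored
-- like `v`.
open Classical in
theorem Partial.treat (hT : Rooted n a r par dep) {P : Set ℕ} {res col : ℕ → ℕ}
    (h : Partial n r par c P res col) (hP : ∀ x < n, x ≠ r → par x ∈ P → x ∈ P) {v K : ℕ}
    (hv : v < n) (hvP : v ∉ P) (hch : ∀ w ∈ children n r par v, w ∈ P) {S : Finset ℕ}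
    (hS : S ⊆ children n r par v) (hSc : ∑ w ∈ S, res w ≤ c) (hK : K ≠ 0)
    (hKcol : ∀ x < n, col x ≠ K) {B : ℕ} (hB : ∑ w ∈ S, res w = B)
    (hR : (∑ w ∈ children n r par v, res w - B) + res v ≤ c) :
    Partial n r par c (insert v P)
      (Function.update res v (res v + (∑ w ∈ children n r par v, res w - B)))
      (recolor n r par col S K) := by
  have hchn : ∀ w ∈ children n r par v, w < n := fun w hw => (mem_children.1 hw).1
  have hch0 : ∀ w ∈ children n r par v, col w = 0 := fun w hw =>
    h.uncolored w (hchn w hw) (mem_children.1 hw).2.1 ((mem_children.1 hw).2.2 ▸ hvP)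
  have hSP : ∀ x, Below n r par S x → x ∈ P := by
    intro x hx
    induction hx with
    | base hn h' => exact hch _ (hS h')
    | step hn hr _ ih => exact hP _ hn hr ih
  have hdep : ∀ x, Below n r par S x → dep v < dep x := by
    intro x hx
    obtain ⟨z, hz, -, hb⟩ := hx.exists_mem
    have := hT.dep_child (hS hz)
    have := hT.dep_le_of_below hb
    omega
  have hnew : ∀ x, (recolor n r par col S K x = 0 ↔ col x = 0 ∧ ¬ Below n r par S x) := by
    intro x
    unfold recolor
    split_ifs with hx
    · simp [hK, hx]
    · tauto
  have hrS : ∀ x, Below n r par S x → x ≠ r := by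
    rintro x hx rfl
    have := hdep _ hx
    have := hT.dep_root
    omega
  have hold : ∀ x, ¬ Below n r par S x → recolor n r par col S K x = col x := by
    intro x hx; simp [recolor, hx]
  have hold' : ∀ x, col x ≠ 0 → recolor n r par col S K x = col x := by
    intro x hx; simp [recolor, hx]
  have hin : ∀ x, col x = 0 → Below n r par S x → recolor n r par col S K x = K := by
    intro x hx hx'; simp [recolor, hx, hx']
  refine ⟨?_, ?_, ?_, ?_, ?_, ?_, ?_⟩
  · intro x hx hxP
    rw [Set.mem_insert_iff, not_or] at hxP
    rw [Function.update_of_ne hxP.1]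
    exact h.res_eq x hx hxP.2
  · intro x hx
    rw [Function.update_apply]
    split_ifs
    · omega
    · exact h.res_le x hx
  · rw [hold r fun hr => hrS r hr rfl, h.col_root]
  · intro x hx hxr hxP
    rw [Set.mem_insert_iff, not_or] at hxP
    rw [hnew]
    refine ⟨h.uncolored x hx hxr hxP.2, fun hb => ?_⟩
    rcases (below_iff hx).1 hb with hb | ⟨-, hb⟩
    · exact hxP.1 (mem_children.1 (hS hb)).2.2
    · exact hxP.2 (hSP _ hb)
  · intro k hk
    by_cases hkK : k = K
    · subst hkK
      refine le_trans ?_ hSc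
      calc #{x ∈ range n | x ≠ r ∧ recolor n r par col S k x = k}
          ≤ #(S.biUnion (colored n r par col 0)) := by
            refine card_le_card fun x hx => ?_
            simp only [mem_filter, mem_range] at hx
            obtain ⟨hxn, hxr, hx⟩ := hx
            have hb : col x = 0 ∧ Below n r par S x := by
              by_contra hb
              rw [recolor, if_neg hb] at hx
              exact hKcol x hxn hx
            obtain ⟨z, hz, -, hz'⟩ := hb.2.exists_mem
            exact mem_biUnion.2 ⟨z, hz, mem_colored.2 ⟨hxn, hxr, hb.1, hz'⟩⟩
        _ = ∑ w ∈ S, res w := by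
            rw [← hT.sum_colored col 0 v S hS]
            exact sum_congr rfl fun w hw =>
              h.card_uncolored w (hchn w (hS hw)) (hch w (hS hw)) (hch0 w (hS hw))
    · refine le_trans (card_le_card fun x hx => ?_) (h.group k hk)
      simp only [mem_filter, mem_range] at hx ⊢
      refine ⟨hx.1, hx.2.1, ?_⟩
      have := hx.2.2
      unfold recolor at this
      split_ifs at this
      · exact absurd this.symm hkK
      · exact this
  · intro v' hv' hv'P
    rcases hv'P with rfl | hv'P
    · refine ⟨K, hK, fun w hw => ?_⟩
      by_cases hb : Below n r par S w
      · exact .inl (hin w (hch0 w hw) hb)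
      · rw [hold w hb, hch0 w hw]
        by_cases hr : v' = r
        · subst hr
          rw [hold _ fun hb => hrS _ hb rfl, h.col_root]
          exact .inr rfl
        · refine .inr ((hnew v').2 ⟨h.uncolored v' hv' hr fun hp => hvP (hP v' hv' hr hp), ?_⟩).symm
          intro hb'
          have := hdep _ hb'
          omega
    · obtain ⟨L, hL, hw⟩ := h.two v' hv' hv'P
      refine ⟨L, hL, fun w hw' => ?_⟩
      obtain ⟨hwn, hwr, hwv⟩ := mem_children.1 hw'
      -- A child of the treated vertex `v'` cannot itself be in `S`: its parent would then be `v`,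
      -- which is untreated.
      have hbw : Below n r par S w ↔ Below n r par S v' := by
        rw [below_iff hwn, hwv]
        refine ⟨fun hx => hx.elim (fun hx => ?_) (·.2), fun hx => .inr ⟨hwr, hx⟩⟩
        refine absurd ?_ hvP
        rw [← (mem_children.1 (hS hx)).2.2, hwv]
        exact hv'P
      rcases hw w hw' with hw | hw
      · exact .inl ((hold' w (hw ▸ hL)).trans hw)
      · refine .inr ?_
        by_cases hz : col v' = 0
        · by_cases hb : Below n r par S v'
          · rw [hin w (hw.trans hz) (hbw.2 hb), hin v' hz hb]
          · rw [hold w fun h' => hb (hbw.1 h'), hold v' hb, hw]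
        · rw [hold' v' hz, hold' w (hw ▸ hz), hw]
  · intro v' hv' hv'P h0
    rw [hnew] at h0
    have hsame : ∀ u, (∀ x, Below n r par {u} x → ¬ Below n r par S x) →
        colored n r par (recolor n r par col S K) 0 u = colored n r par col 0 u := by
      intro u hu
      ext x
      simp only [mem_colored, hnew]
      constructor
      · rintro ⟨h₁, h₂, h₃, h₄⟩
        exact ⟨h₁, h₂, h₃.1, h₄⟩
      · rintro ⟨h₁, h₂, h₃, h₄⟩
        exact ⟨h₁, h₂, ⟨h₃, hu x h₄⟩, h₄⟩
    rcases hv'P with rfl | hv'P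
    · rw [Function.update_self, hT.card_colored _ hv']
      -- After recoloring, the subtrees of children in `S` contain no uncolored edge, and those of
      -- the other children are unchanged.
      have h₁ : ∑ w ∈ children n r par v', #(colored n r par (recolor n r par col S K) 0 w) =
          ∑ w ∈ children n r par v' \ S, res w := by
        rw [← sum_sdiff hS, add_eq_left.2]
        · refine sum_congr rfl fun w hw => ?_
          rw [mem_sdiff] at hw
          rw [hsame, h.card_uncolored w (hchn w hw.1) (hch w hw.1) (hch0 w hw.1)]
          intro x hx hx'
          obtain ⟨z, hz, -, hz'⟩ := hx'.exists_mem
          have h₁ := hT.dep_child hw.1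
          have h₂ := hT.dep_child (hS hz)
          exact hw.2 (hT.eq_of_below hx hz' (by omega) ▸ hz)
        · refine sum_eq_zero fun w hw => card_eq_zero.2 (eq_empty_of_forall_notMem fun x hx => ?_)
          rw [mem_colored, hnew] at hx
          refine hx.2.2.1.2 (hx.2.2.2.mono ?_)
          simpa using hw
      have h₂ := sum_sdiff (f := res) hS
      rw [h₁, (hnew v').2 h0, h.res_eq v' hv' hvP]
      by_cases hr : v' = r
      · subst hr
        simp only [ne_eq, not_true_eq_false, false_and, if_false, if_true]
        omega
      · simp only [hr, ne_eq, not_false_eq_true, true_and, if_true, if_false]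
        omega
    · have hne : v' ≠ v := by rintro rfl; exact hvP hv'P
      rw [Function.update_of_ne hne, hsame, h.card_uncolored v' hv' hv'P h0.1]
      -- Everything below `v'` has been treated. If some descendant of `v'` were at or below `S`
      -- although `v'` is not, the path down from `v'` would enter `S` at a child of a treated
      -- vertex, but the parent `v` of all elements of `S` is untreated.
      have hdown : ∀ y, Below n r par {v'} y → y ∈ P := by
        intro y hy
        induction hy with
        | base hn h' => rw [Set.mem_singleton_iff.1 h']; exact hv'P
        | step hn hr _ ih => exact hP _ hn hr ih
      intro x hx
      induction hx with
      | base hn h' => rw [Set.mem_singleton_iff.1 h']; exact h0.2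
      | @step x hn hr hb ih =>
        intro hb'
        rcases (below_iff hn).1 hb' with hx | ⟨-, hx⟩
        · exact hvP ((mem_children.1 (hS hx)).2.2 ▸ hdown _ hb)
        · exact ih hx

/-- The final coloring: the remaining uncolored edges get color `K`. -/
theorem Partial.valid (hT : Rooted n a r par dep) {P : Set ℕ} {res col : ℕ → ℕ}
    (h : Partial n r par c P res col) (hP : ∀ x < n, x ∈ P) {K : ℕ} (hKcol : ∀ x < n, col x ≠ K) :
    Valid n r par c fun x => if col x = 0 then K else col x where
  two v hv := by
    obtain ⟨L, hL, hw⟩ := h.two v hv (hP v hv)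
    -- Since `L ≠ 0`, replacing color `0` by `K` leaves the edges of color `L` alone.
    refine ⟨L, fun w hw' => ?_⟩
    rcases hw w hw' with hw | hw
    · left; simp [hw, hL]
    · right; simp [hw]
  group k := by
    by_cases hk : k = K
    · have hr := hT.root_lt
      refine le_trans (card_le_card fun x hx => ?_)
        ((h.card_uncolored r hr (hP r hr) h.col_root).trans_le (h.res_le r hr))
      simp only [mem_filter, mem_range] at hx
      refine mem_colored.2 ⟨hx.1, hx.2.1, ?_, hT.below_root hx.1⟩
      by_contra h0
      rw [if_neg h0] at hx
      exact hKcol x hx.1 (hx.2.2.trans hk)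
    · by_cases hk0 : k = 0
      · subst hk0
        rw [card_eq_zero.2]
        · exact Nat.zero_le _
        · refine eq_empty_of_forall_notMem fun x hx => ?_
          simp only [mem_filter, mem_range] at hx
          have := hx.2.2
          split_ifs at this with h0
          · exact hk this.symm
          · exact h0 this
      · refine le_trans (card_le_card fun x hx => ?_) (h.group k hk0)
        simp only [mem_filter, mem_range] at hx ⊢
        refine ⟨hx.1, hx.2.1, ?_⟩
        have := hx.2.2
        split_ifs at this with h0
        · exact absurd this.symm hk
        · exact this

end RootedTrees

end MinMaxColoring

namespace MinMaxColoring

/-! ### Verification of the maximum degree computation -/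

section Procedures

open Finset

variable {R A : Type} [DecidableEq R] [DecidableEq A]

set_option linter.unusedSectionVars false in
@[simp] theorem Exp.eval_zero (σ : Memory R A) : (0 : Exp R A).eval σ = 0 := rfl

set_option linter.unusedSectionVars false in
@[simp] theorem Exp.eval_one (σ : Memory R A) : (1 : Exp R A).eval σ = 1 := rfl

set_option linter.unusedSectionVars false in
theorem wp_putVec {N : ℕ} {Q : Memory R A → Prop} {σ : Memory R A} {a : A} {j e : Exp R A}
    (h : Q (σ.setCell a 0 (j.eval σ) (e.eval σ))) : Wp N (.putVec a j e) Q σ := wp_put h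

/-- The degree of the vertex `x`. -/
def degree (n : ℕ) (a : ℕ → ℕ → ℕ) (x : ℕ) : ℕ := #{y ∈ range n | a x y = 1}

theorem card_filter_range_succ (p : ℕ → Prop) [DecidablePred p] (k : ℕ) :
    #{y ∈ range (k + 1) | p y} = #{y ∈ range k | p y} + if p k then 1 else 0 := by
  rw [range_add_one, filter_insert]
  split_ifs with h
  · rw [card_insert_of_notMem (by simp)]
  · simp

variable {n N : ℕ} {a : ℕ → ℕ → ℕ} {σ : Memory Reg Arr}

theorem wp_maxDegree (hN : n ≤ N) (hn : σ.reg .n = n) (ha : σ.arr .adj = a) (h0 : 0 < n) :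
    Wp N maxDegree (fun σ' => (∀ x < n, degree n a x ≤ σ'.reg .Delta) ∧
      ∃ x < n, degree n a x = σ'.reg .Delta) σ := by
  refine wp_block_cons (wp_set (wp_block_cons ?_))
  -- Before the first round no vertex attains the value `0`, hence the separate alternative for `k =
  -- 0`.
  refine wp_forTo (fun k σ' => (∀ x < k, degree n a x ≤ σ'.reg .Delta) ∧
    ((k = 0 ∧ σ'.reg .Delta = 0) ∨ ∃ x < k, degree n a x = σ'.reg .Delta)) n hN rfl ?_ ?_ ?_ ?_
  · simp [Memory.setReg_reg]
  · intro k σ' hf _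
    simpa [Exp.eval, Memory.setReg_reg, hn] using hf.reg .n rfl
  · intro x hx σ' hf hrx hI
    have hn' : σ'.reg .n = n := by simpa [Memory.setReg_reg, hn] using hf.reg .n rfl
    have ha' : σ'.arr .adj = a := by simpa [ha] using hf.arr .adj rfl
    refine wp_block_cons (wp_set (wp_block_cons ?_))
    refine wp_forTo (fun k σ' => σ'.reg .k = #{y ∈ range k | a x y = 1}) n hN rfl ?_ ?_ ?_ ?_
    · simp [Memory.setReg_reg]
    · intro k σ₂ hf₂ _
      simpa [Exp.eval, Memory.setReg_reg, hn'] using hf₂.reg .n rfl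
    · intro y hy σ₂ hf₂ hry hI₂
      have ha₂ : σ₂.arr .adj = a := by simpa [ha'] using hf₂.arr .adj rfl
      have hx₂ : σ₂.reg .x = x := by simpa [Memory.setReg_reg, hrx] using hf₂.reg .x rfl
      refine wp_block_cons (wp_when (fun hb => ?_) fun hb => ?_)
      · refine wp_block_cons (wp_set (wp_block_nil (wp_block_nil ?_)))
        simp [Test.eval, Exp.eval, ha₂, hx₂, hry] at hb
        simp [Memory.setReg_reg, Exp.eval, hI₂, card_filter_range_succ, hb]
      · refine wp_block_nil ?_
        simp [Test.eval, Exp.eval, ha₂, hx₂, hry] at hb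
        simp [Memory.setReg_reg, hI₂, card_filter_range_succ, hb]
    · intro σ₂ hf₂ hI₂
      have hD₂ : σ₂.reg .Delta = σ'.reg .Delta := by
        simpa [Memory.setReg_reg] using hf₂.reg .Delta rfl
      have hk : σ₂.reg .k = degree n a x := hI₂
      refine wp_block_cons (wp_when (fun hb => ?_) fun hb => ?_)
      · refine wp_block_cons (wp_set (wp_block_nil (wp_block_nil ?_)))
        simp only [Test.eval, Exp.eval, hk, hD₂, decide_eq_true_eq] at hb
        simp only [Memory.setReg_reg, Exp.eval, reduceCtorEq, if_true, if_false, hk]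
        refine ⟨fun y hy => ?_, .inr ⟨x, by omega, rfl⟩⟩
        rcases Nat.lt_succ_iff_lt_or_eq.1 hy with hy | rfl
        · exact (hI.1 y hy).trans hb.le
        · exact le_rfl
      · refine wp_block_nil ?_
        simp only [Test.eval, Exp.eval, hk, hD₂, decide_eq_false_iff_not, not_lt] at hb
        simp only [Memory.setReg_reg, reduceCtorEq, if_false, hD₂]
        refine ⟨fun y hy => ?_, ?_⟩
        · rcases Nat.lt_succ_iff_lt_or_eq.1 hy with hy | rfl
          · exact hI.1 y hy
          · exact hb
        · rcases hI.2 with ⟨rfl, h⟩ | ⟨y, hy, h⟩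
          · exact .inr ⟨0, by omega, by omega⟩
          · exact .inr ⟨y, by omega, h⟩
  · rintro σ' hf ⟨h₁, ⟨h₂, -⟩ | h₂⟩
    · omega
    · exact wp_block_nil ⟨h₁, h₂⟩

end Procedures

end MinMaxColoring

namespace MinMaxColoring

/-! ### Filling and copying arrays, breadth-first labels, lists of children -/

section Procedures

open Finset

variable {n N r c : ℕ} {a : ℕ → ℕ → ℕ} {par dep : ℕ → ℕ} {σ : Memory Reg Arr}

theorem wp_fill (b : Arr) {e : Exp Reg Arr} {v : ℕ} (he : ∀ σ, e.eval σ = v) (hN : n ≤ N)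
    (hn : σ.reg .n = n) :
    Wp N (forTo .x (.reg .n) [.putVec b (.reg .x) e]) (fun σ' => ∀ x < n, σ'.arr b 0 x = v) σ := by
  refine wp_forTo (fun k σ' => ∀ x < k, σ'.arr b 0 x = v) n hN rfl (by simp) ?_ ?_ ?_
  · intro k σ' hf _
    simpa [Exp.eval, hn] using hf.reg .n rfl
  · intro k hk σ' hf hx hI
    refine wp_block_cons (wp_putVec (wp_block_nil ?_))
    intro x hx'
    simp only [Memory.setReg_arr, Memory.setCell_arr, Exp.eval, hx, he, true_and]
    split_ifs
    · rfl
    · exact hI x (by omega)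
  · exact fun σ' _ h => h

/-- The value written may depend on the loop registers and on arrays other than `b`, none of which
the body changes; this covers both constant matrices and copies. -/
theorem wp_fillMatrix (b : Arr) {e : Exp Reg Arr} {F : ℕ → ℕ → ℕ}
    (he : ∀ σ', (∀ b' ≠ b, σ'.arr b' = σ.arr b') → e.eval σ' = F (σ'.reg .x) (σ'.reg .y))
    (hN : n ≤ N) (hn : σ.reg .n = n) :
    Wp N (forTo .x (.reg .n) [forTo .y (.reg .n) [.put b (.reg .x) (.reg .y) e]])
      (fun σ' => ∀ x < n, ∀ y < n, σ'.arr b x y = F x y) σ := by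
  have hset : ∀ b' ≠ b, (forTo .x (.reg .n) [forTo .y (.reg .n)
      [.put b (.reg .x) (.reg .y) e]] : Cmd Reg Arr).setsArr b' = false := by
    intro b' hb'
    simp [forTo, block, Cmd.setsArr, hb'.symm]
  refine wp_forTo (fun k σ' => ∀ x < k, ∀ y < n, σ'.arr b x y = F x y) n hN rfl (by simp) ?_ ?_ ?_
  · intro k σ' hf _
    simpa [Exp.eval, hn] using hf.reg .n rfl
  · intro x hx σ' hf hrx hI
    have hn' : σ'.reg .n = n := by simpa [hn] using hf.reg .n rfl
    refine wp_block_cons ?_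
    refine wp_forTo (fun k σ' => (∀ x' < x, ∀ y < n, σ'.arr b x' y = F x' y) ∧
      ∀ y < k, σ'.arr b x y = F x y) n hN rfl (by simpa using hI) ?_ ?_ ?_
    · intro k σ₂ hf₂ _
      simpa [Exp.eval, hn'] using hf₂.reg .n rfl
    · intro y hy σ₂ hf₂ hry hI₂
      have hx₂ : σ₂.reg .x = x := by simpa [hrx] using hf₂.reg .x rfl
      have he₂ : e.eval σ₂ = F x y := by
        rw [he σ₂, hx₂, hry]
        intro b' hb'
        rw [hf₂.arr b' (by simp [forTo, block, Cmd.setsArr, hb'.symm]), hf.arr b' (hset b' hb')]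
      refine wp_block_cons (wp_put (wp_block_nil ?_))
      simp only [Memory.setReg_arr, Memory.setCell_arr, Exp.eval, hx₂, hry, he₂, true_and]
      refine ⟨fun x' hx' y' hy' => ?_, fun y' hy' => ?_⟩
      · rw [if_neg (by omega)]
        exact hI₂.1 x' hx' y' hy'
      · split_ifs with h
        · rw [h]
        · exact hI₂.2 y' (by omega)
    · intro σ₂ hf₂ hI₂
      refine wp_block_nil ?_
      intro x' hx' y hy
      rcases Nat.lt_succ_iff_lt_or_eq.1 hx' with h | rfl
      · exact hI₂.1 x' h y hy
      · exact hI₂.2 y hy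
  · exact fun σ' _ h => h

theorem wp_copyColoring {b b' : Arr} (hb : b ≠ b') (hN : n ≤ N) (hn : σ.reg .n = n) :
    Wp N (copyColoring b b') (fun σ' => ∀ x < n, ∀ y < n, σ'.arr b' x y = σ.arr b x y) σ :=
  wp_fillMatrix b' (fun σ' h => by simp [Exp.eval, h b hb]) hN hn

theorem Rooted.adj_symm (hT : Rooted n a r par dep) {x y : ℕ} (hx : x < n) (hy : y < n) :
    a x y = 1 ↔ a y x = 1 := by
  rw [hT.adj_iff x hx y hy, hT.adj_iff y hy x hx, or_comm]

/-- This is the form in which the program recognizes children: the distance rules out the parent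
among the neighbors. -/
theorem Rooted.mem_children_iff (hT : Rooted n a r par dep) {v w : ℕ} (hv : v < n) (hw : w < n) :
    w ∈ children n r par v ↔ a v w = 1 ∧ dep w = dep v + 1 := by
  rw [hT.adj_iff v hv w hw, mem_children]
  constructor
  · rintro ⟨-, h, rfl⟩
    exact ⟨.inr ⟨h, rfl⟩, hT.dep_par w hw h⟩
  · rintro ⟨⟨h, rfl⟩ | h, h'⟩
    · have := hT.dep_par v hv h
      omega
    · exact ⟨hw, h⟩

theorem Rooted.dep_eq_zero (hT : Rooted n a r par dep) {x : ℕ} (hx : x < n) :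
    dep x = 0 ↔ x = r := by
  refine ⟨fun h => by_contra fun hr => ?_, fun h => h ▸ hT.dep_root⟩
  have := hT.dep_par x hx hr
  omega

/-- Round `d` labels exactly the vertices at distance `d + 1`. Their label `d + 2` keeps them from
being expanded in the same round, and an unlabeled neighbor of an expanded vertex must be its child.
All depths are below `n`, so `n` rounds suffice. -/
theorem wp_labelVertices (hT : Rooted n a r par dep) (hN : n ≤ N) (hn : σ.reg .n = n)
    (ha : σ.arr .adj = a) (hr : σ.reg .root = r) :
    Wp N labelVertices (fun σ' => ∀ x < n, σ'.arr .label 0 x = dep x + 1) σ := by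
  refine wp_block_cons ((wp_fill .label (fun σ => Exp.eval_zero σ) hN hn).mono fun σ₁ hf₁ hz => ?_)
  refine wp_block_cons (wp_putVec (wp_block_cons ?_))
  have hn₁ : σ₁.reg .n = n := by simpa [hn] using hf₁.reg .n rfl
  have ha₁ : σ₁.arr .adj = a := by simpa [ha] using hf₁.arr .adj rfl
  have hr₁ : σ₁.reg .root = r := by simpa [hr] using hf₁.reg .root rfl
  refine wp_forTo (fun d σ' => ∀ z < n, σ'.arr .label 0 z = if dep z ≤ d then dep z + 1 else 0)
    n hN rfl ?_ ?_ ?_ ?_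
  · intro z hz'
    simp only [Memory.setReg_arr, Memory.setCell_arr, Exp.eval, hr₁, true_and,
      Nat.le_zero, hT.dep_eq_zero hz', hz z hz']
    split_ifs with h
    · rw [h, hT.dep_root]
    · rfl
  · intro k σ' hf _
    simpa [Exp.eval, hn₁] using hf.reg .n rfl
  · intro d hd σ₂ hf₂ hrd hI₂
    have hn₂ : σ₂.reg .n = n := by simpa [hn₁] using hf₂.reg .n rfl
    have ha₂ : σ₂.arr .adj = a := by
      rw [hf₂.arr .adj rfl, Memory.setCell_arr_ne _ _ _ _ _ _ (by decide), ha₁]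
    refine wp_block_cons ?_
    refine wp_forTo (fun k σ' => ∀ z < n, σ'.arr .label 0 z =
      if dep z ≤ d ∨ (dep z = d + 1 ∧ par z < k) then dep z + 1 else 0) n hN rfl ?_ ?_ ?_ ?_
    · simpa using hI₂
    · intro k σ' hf _
      simpa [Exp.eval, hn₂] using hf.reg .n rfl
    · intro x hx σ₃ hf₃ hrx hI₃
      have hn₃ : σ₃.reg .n = n := by simpa [hn₂] using hf₃.reg .n rfl
      have ha₃ : σ₃.arr .adj = a := by simpa [ha₂] using hf₃.arr .adj rfl
      have hd₃ : σ₃.reg .d = d := by simpa [Memory.setReg_reg, hrd] using hf₃.reg .d rfl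
      refine wp_block_cons (wp_when (fun hb => ?_) fun hb => ?_)
      · simp only [Test.eval, Exp.vec, Exp.eval, hrx, hd₃, hI₃ x hx,
          decide_eq_true_eq] at hb
        have hdx : dep x = d := by
          split_ifs at hb
          omega
        refine wp_block_cons ?_
        -- Lexicographic progress: children of vertices before `x` are done, and children of `x` are
        -- done up to `k`.
        refine wp_forTo (fun k σ' => ∀ z < n, σ'.arr .label 0 z =
          if dep z ≤ d ∨ (dep z = d + 1 ∧ (par z < x ∨ par z = x ∧ z < k)) then dep z + 1 else 0)
          n hN rfl ?_ ?_ ?_ ?_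
        · simpa using hI₃
        · intro k σ' hf _
          simpa [Exp.eval, hn₃] using hf.reg .n rfl
        · intro y hy σ₄ hf₄ hry hI₄
          have ha₄ : σ₄.arr .adj = a := by simpa [ha₃] using hf₄.arr .adj rfl
          have hd₄ : σ₄.reg .d = d := by simpa [Memory.setReg_reg, hd₃] using hf₄.reg .d rfl
          have hx₄ : σ₄.reg .x = x := by simpa [Memory.setReg_reg, hrx] using hf₄.reg .x rfl
          refine wp_block_cons (wp_when (fun hb => ?_) fun hb => ?_)
          · simp only [Test.eval, Exp.vec, Exp.eval, hx₄, hry, ha₄,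
              hI₄ y hy, decide_eq_true_eq, Bool.and_eq_true] at hb
            obtain ⟨hxy, hb⟩ := hb
            have hdy : d < dep y := by
              by_contra h
              rw [if_pos (.inl (by omega))] at hb
              omega
            have hyx : y ≠ r ∧ par y = x := by
              rcases (hT.adj_iff x hx y hy).1 hxy with ⟨h, rfl⟩ | h
              · have := hT.dep_par x hx h
                omega
              · exact h
            have hdy' := hT.dep_par y hy hyx.1
            rw [hyx.2, hdx] at hdy'
            refine wp_block_cons (wp_putVec (wp_block_nil (wp_block_nil ?_)))
            intro z hz'
            simp only [Memory.setReg_arr, Memory.setCell_arr, Exp.eval, hry, hd₄,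
              true_and, hI₄ z hz']
            by_cases hzy : z = y
            · subst hzy
              rw [if_pos rfl, if_pos (.inr ⟨hdy', .inr ⟨hyx.2, by omega⟩⟩), hdy']
            · rw [if_neg hzy]
              refine if_congr ?_ rfl rfl
              have : z < y + 1 ↔ z < y := by omega
              rw [this]
          · refine wp_block_nil ?_
            simp only [Test.eval, Exp.vec, Exp.eval, hx₄, hry, ha₄,
              hI₄ y hy, Bool.and_eq_false_iff, decide_eq_false_iff_not] at hb
            intro z hz'
            rw [Memory.setReg_arr, hI₄ z hz']
            refine if_congr ?_ rfl rfl
            by_cases hzy : z = y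
            · subst hzy
              refine ⟨fun h => h.imp_right fun h => ⟨h.1, h.2.imp_right fun h => ⟨h.1, by omega⟩⟩,
                fun h => ?_⟩
              -- If only the new range covers `z`, then `z` is a still unlabeled child of `x`, so
              -- the test would have succeeded.
              by_contra hno
              have hzr : z ≠ r := by
                rintro rfl
                have := hT.dep_root
                omega
              rw [if_neg hno] at hb
              have hpx : par z = x := by omega
              exact hb.elim (fun hb => hb ((hT.adj_iff x hx z hz').2 (.inr ⟨hzr, hpx⟩)))
                fun hb => hb rfl
            · have : z < y + 1 ↔ z < y := by omega
              rw [this]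
        · intro σ₄ hf₄ hI₄
          refine wp_block_nil (wp_block_nil ?_)
          intro z hz'
          rw [Memory.setReg_arr, hI₄ z hz']
          refine if_congr ?_ rfl rfl
          have : par z < x + 1 ↔ (par z < x ∨ par z = x ∧ z < n) := by omega
          rw [this]
      · refine wp_block_nil ?_
        simp only [Test.eval, Exp.vec, Exp.eval, hrx, hd₃, hI₃ x hx,
          decide_eq_false_iff_not] at hb
        intro z hz'
        rw [Memory.setReg_arr, hI₃ z hz']
        refine if_congr ?_ rfl rfl
        refine ⟨fun h => h.imp_right fun h => ⟨h.1, by omega⟩, fun h => ?_⟩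
        by_contra hno
        have hzr : z ≠ r := by
          rintro rfl
          have := hT.dep_root
          omega
        have hpx : par z = x := by omega
        have := hT.dep_par z hz' hzr
        rw [hpx] at this
        rw [if_pos (.inl (by omega))] at hb
        omega
    · intro σ₃ hf₃ hI₃
      refine wp_block_nil ?_
      intro z hz'
      rw [Memory.setReg_arr, hI₃ z hz']
      refine if_congr ?_ rfl rfl
      constructor
      · omega
      · intro h
        by_cases h0 : dep z ≤ d
        · exact .inl h0
        · refine .inr ⟨by omega, hT.par_lt z hz' ?_⟩
          rintro rfl
          have := hT.dep_root
          omega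
  · intro σ₂ hf₂ hI₂
    refine wp_block_nil fun z hz' => ?_
    rw [hI₂ z hz', if_pos (hT.dep_lt z hz').le]

/-- The current list of children enumerates the finite set `C`. -/
structure Lists (σ : Memory Reg Arr) (C : Finset ℕ) : Prop where
  count_eq : σ.reg .count = #C
  mem : ∀ i < σ.reg .count, σ.arr .child 0 i ∈ C
  inj : ∀ i < σ.reg .count, ∀ j < σ.reg .count,
    σ.arr .child 0 i = σ.arr .child 0 j → i = j

theorem wp_listChildren (hT : Rooted n a r par dep) (hN : n ≤ N) (hn : σ.reg .n = n)
    (ha : σ.arr .adj = a) (hl : ∀ x < n, σ.arr .label 0 x = dep x + 1) {v : ℕ} (hv : v < n)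
    (hrv : σ.reg .v = v) (hd : σ.reg .d = dep v + 1) :
    Wp N listChildren (fun σ' => Lists σ' (children n r par v) ∧
      σ'.reg .total = ∑ w ∈ children n r par v, σ.arr .res 0 w) σ := by
  refine wp_block_cons (wp_set (wp_block_cons (wp_set (wp_block_cons ?_))))
  refine wp_forTo (fun k σ' => Lists σ' {w ∈ range k | w ∈ children n r par v} ∧
    σ'.reg .total = ∑ w ∈ range k with w ∈ children n r par v, σ.arr .res 0 w) n hN rfl ?_ ?_ ?_ ?_
  · refine ⟨⟨?_, ?_, ?_⟩, ?_⟩ <;> simp [Memory.setReg_reg]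
  · intro k σ' hf _
    simpa [Exp.eval, Memory.setReg_reg, hn] using hf.reg .n rfl
  · rintro w hw σ' hf hrw ⟨hI, htot⟩
    have hn' : σ'.reg .n = n := by simpa [Memory.setReg_reg, hn] using hf.reg .n rfl
    have ha' : σ'.arr .adj = a := by simpa [ha] using hf.arr .adj rfl
    have hv' : σ'.reg .v = v := by simpa [Memory.setReg_reg, hrv] using hf.reg .v rfl
    have hd' : σ'.reg .d = dep v + 1 := by simpa [Memory.setReg_reg, hd] using hf.reg .d rfl
    have hl' : σ'.arr .label = σ.arr .label := by simpa using hf.arr .label rfl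
    have hr' : σ'.arr .res = σ.arr .res := by simpa using hf.arr .res rfl
    refine wp_block_cons (wp_when (fun hb => ?_) fun hb => ?_)
    · simp only [Test.eval, Exp.vec, Exp.eval, ha', hv', hrw, hl', hd', hl w hw,
        Bool.and_eq_true, decide_eq_true_eq, add_left_inj] at hb
      have hmem : w ∈ children n r par v := (hT.mem_children_iff hv hw).2 hb
      have hins : {w' ∈ range (w + 1) | w' ∈ children n r par v} =
          insert w {w' ∈ range w | w' ∈ children n r par v} := by
        rw [range_add_one, filter_insert, if_pos hmem]
      have hnot : w ∉ {w' ∈ range w | w' ∈ children n r par v} := by simp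
      refine wp_block_cons (wp_putVec (wp_block_cons (wp_set (wp_block_cons (wp_set
        (wp_block_nil (wp_block_nil ?_)))))))
      rw [hins, sum_insert hnot]
      have hlt : ∀ i < σ'.reg .count, σ'.arr .child 0 i ≠ w := by
        intro i hi h
        have := hI.mem i hi
        rw [h] at this
        exact hnot this
      refine ⟨⟨?_, ?_, ?_⟩, ?_⟩
      · simp [Memory.setReg_reg, Exp.eval, card_insert_of_notMem hnot, hI.count_eq]
      · intro i hi
        simp only [Memory.setReg_reg, Memory.setReg_arr, Memory.setCell_reg, Exp.eval,
          reduceCtorEq, if_true, if_false, Memory.setCell_arr, true_and, hrw] at hi ⊢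
        split_ifs with h
        · exact mem_insert_self _ _
        · exact mem_insert_of_mem (hI.mem i (by omega))
      · intro i hi j hj
        simp only [Memory.setReg_reg, Memory.setReg_arr, Memory.setCell_reg, Exp.eval,
          reduceCtorEq, if_true, if_false, Memory.setCell_arr, true_and, hrw] at hi hj ⊢
        split_ifs with h h' h'
        · omega
        · exact fun h => absurd h.symm (hlt j (by omega))
        · exact fun h => absurd h (hlt i (by omega))
        · exact hI.inj i (by omega) j (by omega)
      · simp [Memory.setReg_reg, Exp.eval, Exp.vec, Memory.setCell_arr, htot, hr', hrw, add_comm]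
    · refine wp_block_nil ?_
      simp only [Test.eval, Exp.vec, Exp.eval, ha', hv', hrw, hl', hd', hl w hw,
        ← Bool.not_eq_true, Bool.and_eq_true, decide_eq_true_eq, add_left_inj] at hb
      have hmem : w ∉ children n r par v := fun h => hb ((hT.mem_children_iff hv hw).1 h)
      rw [range_add_one, filter_insert, if_neg hmem]
      exact ⟨⟨hI.count_eq, hI.mem, hI.inj⟩, htot⟩
  · rintro σ' hf ⟨hI, htot⟩
    have : {w ∈ range n | w ∈ children n r par v} = children n r par v := by
      ext w
      simp only [mem_filter, mem_range, mem_children]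
      tauto
    rw [this] at hI htot
    exact wp_block_nil ⟨hI, htot⟩

end Procedures

end MinMaxColoring

namespace MinMaxColoring

/-! ### The knapsack table, reading off a solution, marking descendants -/

section Knapsack

open Finset

/-- The table of the knapsack problem whose items have sizes (and values) `s 0, s 1, …`. -/
def knap (s : ℕ → ℕ) : ℕ → ℕ → ℕ
  | 0, _ => 0
  | i + 1, w =>
    if s i ≤ w ∧ knap s i w < knap s i (w - s i) + s i then knap s i (w - s i) + s i
    else knap s i w

theorem knap_le (s : ℕ → ℕ) (i w : ℕ) : knap s i w ≤ w := by
  induction i generalizing w with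
  | zero => exact Nat.zero_le w
  | succ i ih =>
    have h₁ := ih w
    have h₂ := ih (w - s i)
    rw [knap]
    split_ifs <;> omega

/-- Induction on the number of items: if item `i` is selected, the rest fits into capacity `w - s
i`; otherwise the selection already competes in the previous row. -/
theorem le_knap (s : ℕ → ℕ) (p : ℕ → Prop) [DecidablePred p] (i w : ℕ)
    (h : ∑ j ∈ range i with p j, s j ≤ w) : ∑ j ∈ range i with p j, s j ≤ knap s i w := by
  induction i generalizing w with
  | zero => simp
  | succ i ih =>
    rw [range_add_one, filter_insert] at h ⊢
    rw [knap]
    by_cases hp : p i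
    · rw [if_pos hp, sum_insert (by simp)] at h ⊢
      have := ih (w - s i) (by omega)
      split_ifs <;> omega
    · rw [if_neg hp] at h ⊢
      have := ih w h
      split_ifs <;> omega

variable {n N r c : ℕ} {a : ℕ → ℕ → ℕ} {par dep : ℕ → ℕ} {σ : Memory Reg Arr}

/-- The size of the `i`-th item on the list of children. -/
def itemSize (σ : Memory Reg Arr) (i : ℕ) : ℕ := σ.arr .res 0 (σ.arr .child 0 i)

theorem Lists.image_eq {C : Finset ℕ} (h : Lists σ C) :
    (range (σ.reg .count)).image (σ.arr .child 0) = C := by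
  refine eq_of_subset_of_card_le ?_ ?_
  · intro x hx
    obtain ⟨i, hi, rfl⟩ := mem_image.1 hx
    exact h.mem i (mem_range.1 hi)
  · rw [card_image_of_injOn, card_range, h.count_eq]
    intro i hi j hj
    exact h.inj i (by simpa using hi) j (by simpa using hj)

/-- The list of children is injective, so a set of children is a set of list positions with the same
total size. -/
theorem Lists.sum_le_knap {C : Finset ℕ} (h : Lists σ C) {S : Finset ℕ} (hS : S ⊆ C)
    (hc : ∑ w ∈ S, σ.arr .res 0 w ≤ c) :
    ∑ w ∈ S, σ.arr .res 0 w ≤ knap (itemSize σ) (σ.reg .count) c := by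
  have hSi : S = ({i ∈ range (σ.reg .count) | σ.arr .child 0 i ∈ S}).image (σ.arr .child 0) := by
    ext x
    simp only [mem_image, mem_filter]
    constructor
    · intro hx
      have := hS hx
      rw [← h.image_eq] at this
      obtain ⟨i, hi, rfl⟩ := mem_image.1 this
      exact ⟨i, ⟨hi, hx⟩, rfl⟩
    · rintro ⟨i, ⟨-, hi⟩, rfl⟩
      exact hi
  have hsum : ∑ w ∈ S, σ.arr .res 0 w =
      ∑ i ∈ range (σ.reg .count) with σ.arr .child 0 i ∈ S, itemSize σ i := by
    conv_lhs => rw [hSi]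
    rw [sum_image]
    · rfl
    · intro i hi j hj
      simp only [coe_filter, mem_range, Set.mem_ofPred_eq] at hi hj
      exact h.inj i hi.1 j hj.1
  rw [hsum] at hc ⊢
  exact le_knap _ _ _ _ hc

theorem wp_solveKnapsack (hc : σ.reg .c = c) (hcN : c + 1 ≤ N) (hcount : σ.reg .count ≤ N) :
    Wp N solveKnapsack (fun σ' => ∀ i ≤ σ.reg .count, ∀ w ≤ c,
      σ'.arr .opt i w = knap (itemSize σ) i w) σ := by
  refine wp_block_cons ?_
  refine wp_forTo (fun k σ' => ∀ w < k, σ'.arr .opt 0 w = 0) (c + 1) hcN rfl (by simp) ?_ ?_ ?_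
  · intro k σ' hf _
    simpa [Exp.eval, hc] using hf.reg .c rfl
  · intro k hk σ' hf hx hI
    refine wp_block_cons (wp_put (wp_block_nil ?_))
    intro w hw
    simp only [Memory.setReg_arr, Memory.setCell_arr, Exp.eval, hx, true_and]
    split_ifs
    · rfl
    · exact hI w (by omega)
  intro σ₁ hf₁ hI₁
  have hc₁ : σ₁.reg .c = c := by simpa [hc] using hf₁.reg .c rfl
  have hcount₁ : σ₁.reg .count = σ.reg .count := hf₁.reg .count rfl
  have hres₁ : σ₁.arr .res = σ.arr .res := hf₁.arr .res rfl
  have hchild₁ : σ₁.arr .child = σ.arr .child := hf₁.arr .child rfl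
  refine wp_block_cons ?_
  refine wp_forTo (fun k σ' => ∀ i ≤ k, ∀ w ≤ c, σ'.arr .opt i w = knap (itemSize σ) i w)
    (σ.reg .count) hcount rfl ?_ ?_ ?_ ?_
  · intro i hi w hw
    rw [Nat.le_zero.1 hi, knap]
    exact hI₁ w (by omega)
  · intro k σ' hf _
    simpa [Exp.eval, hcount₁] using hf.reg .count rfl
  · intro i hi σ₂ hf₂ hri hI₂
    have hc₂ : σ₂.reg .c = c := by simpa [hc₁] using hf₂.reg .c rfl
    have hres₂ : σ₂.arr .res = σ.arr .res := by simpa [hres₁] using hf₂.arr .res rfl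
    have hchild₂ : σ₂.arr .child = σ.arr .child := by simpa [hchild₁] using hf₂.arr .child rfl
    refine wp_block_cons (wp_set (wp_block_cons ?_))
    simp only [Exp.vec, Exp.eval, hres₂, hchild₂, hri]
    refine wp_forTo (fun k σ' => (∀ i' ≤ i, ∀ w ≤ c, σ'.arr .opt i' w = knap (itemSize σ) i' w) ∧
      ∀ w < k, σ'.arr .opt (i + 1) w = knap (itemSize σ) (i + 1) w) (c + 1) hcN rfl ?_ ?_ ?_ ?_
    · simpa using hI₂
    · intro k σ' hf _
      simpa [Exp.eval, Memory.setReg_reg, hc₂] using hf.reg .c rfl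
    · rintro w hw σ₃ hf₃ hrw ⟨hI₃, hI₃'⟩
      have hi₃ : σ₃.reg .i = i := by simpa [Memory.setReg_reg, hri] using hf₃.reg .i rfl
      have hs₃ : σ₃.reg .size = itemSize σ i := by
        simpa [Memory.setReg_reg, itemSize] using hf₃.reg .size rfl
      -- Writing row `i + 1` does not disturb row `i`, from which the new entries are computed.
      have hne : (i = i + 1) = False := by simp
      refine wp_block_cons (wp_put ?_)
      refine wp_block_cons (wp_when (fun hb => ?_) fun hb => ?_)
      · simp only [Test.eval, Exp.eval, hi₃, hs₃, hrw, Memory.setCell_reg, Memory.setCell_arr,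
          true_and, hne, false_and, if_false, hI₃ i le_rfl w (by omega),
          hI₃ i le_rfl (w - itemSize σ i) (by omega), Bool.and_eq_true, decide_eq_true_eq] at hb
        refine wp_block_cons (wp_put (wp_block_nil (wp_block_nil ?_)))
        simp only [Exp.eval, hi₃, hs₃, hrw, Memory.setCell_reg, Memory.setReg_arr,
          Memory.setCell_arr, true_and, hne, false_and, if_false,
          hI₃ i le_rfl (w - itemSize σ i) (by omega)]
        refine ⟨fun i' hi' w' hw' => ?_, fun w' hw' => ?_⟩
        · rw [if_neg (by omega), if_neg (by omega)]
          exact hI₃ i' hi' w' hw'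
        · by_cases h : w' = w
          · rw [if_pos h, knap, h, if_pos hb]
          · rw [if_neg h, if_neg h]
            exact hI₃' w' (by omega)
      · simp only [Test.eval, Exp.eval, hi₃, hs₃, hrw, Memory.setCell_reg, Memory.setCell_arr,
          true_and, hne, false_and, if_false, hI₃ i le_rfl w (by omega),
          hI₃ i le_rfl (w - itemSize σ i) (by omega), ← Bool.not_eq_true, Bool.and_eq_true,
          decide_eq_true_eq] at hb
        refine wp_block_nil ?_
        simp only [Exp.eval, hi₃, hrw, Memory.setReg_arr,
          Memory.setCell_arr, true_and, hI₃ i le_rfl w (by omega)]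
        refine ⟨fun i' hi' w' hw' => ?_, fun w' hw' => ?_⟩
        · rw [if_neg (by omega)]
          exact hI₃ i' hi' w' hw'
        · by_cases h : w' = w
          · rw [if_pos h, knap, h, if_neg hb]
          · rw [if_neg h]
            exact hI₃' w' (by omega)
    · rintro σ₃ hf₃ ⟨hI₃, hI₃'⟩
      refine wp_block_nil ?_
      intro i' hi' w hw
      rcases Nat.le_succ_iff.1 hi' with h | rfl
      · exact hI₃ i' h w hw
      · exact hI₃' w (by omega)
  · exact fun σ' _ h => wp_block_nil h

/-- Backtracking through the table: the entry grows from row `i` to row `i + 1` exactly when the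
recursion takes item `i`. The size of the set found so far plus the optimum for the remaining items
and capacity stays equal to the full optimum. -/
theorem wp_markSolution (hN : n ≤ N) (hn : σ.reg .n = n) (hc : σ.reg .c = c)
    (hcount : σ.reg .count ≤ N) {C : Finset ℕ} (hC : Lists σ C)
    (hopt : ∀ i ≤ σ.reg .count, ∀ w ≤ c, σ.arr .opt i w = knap (itemSize σ) i w) :
    Wp N markSolution (fun σ' => ∃ S ⊆ C, (∀ x < n, σ'.arr .mark 0 x = 1 ↔ x ∈ S) ∧
      ∑ w ∈ S, σ.arr .res 0 w = knap (itemSize σ) (σ.reg .count) c) σ := by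
  refine wp_block_cons ((wp_fill .mark (fun σ => Exp.eval_zero σ) hN hn).mono fun σ₁ hf₁ hz => ?_)
  have hc₁ : σ₁.reg .c = c := by simpa [hc] using hf₁.reg .c rfl
  have hcount₁ : σ₁.reg .count = σ.reg .count := hf₁.reg .count rfl
  have hres₁ : σ₁.arr .res = σ.arr .res := hf₁.arr .res rfl
  have hchild₁ : σ₁.arr .child = σ.arr .child := hf₁.arr .child rfl
  have hopt₁ : σ₁.arr .opt = σ.arr .opt := hf₁.arr .opt rfl
  refine wp_block_cons (wp_set (wp_block_cons ?_))
  refine wp_forTo (fun j σ' => σ'.reg .w ≤ c ∧ ∃ S ⊆ C, (∀ x < n, σ'.arr .mark 0 x = 1 ↔ x ∈ S) ∧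
    (∀ i < σ.reg .count - j, σ.arr .child 0 i ∉ S) ∧
    ∑ w ∈ S, σ.arr .res 0 w + knap (itemSize σ) (σ.reg .count - j) (σ'.reg .w) =
      knap (itemSize σ) (σ.reg .count) c) (σ.reg .count) hcount rfl ?_ ?_ ?_ ?_
  · simp only [Memory.setReg_reg, Exp.eval, hc₁, reduceCtorEq, if_true, if_false,
      Memory.setReg_arr]
    refine ⟨le_rfl, ∅, empty_subset _, ?_, by simp, by simp⟩
    intro x hx
    simp [hz x hx]
  · intro k σ' hf _
    simpa [Exp.eval, Memory.setReg_reg, hcount₁] using hf.reg .count rfl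
  · rintro j hj σ₂ hf₂ hrj ⟨hw, S, hSC, hmark, hnot, hsum⟩
    have hcount₂ : σ₂.reg .count = σ.reg .count := by
      simpa [Memory.setReg_reg, hcount₁] using hf₂.reg .count rfl
    have hres₂ : σ₂.arr .res = σ.arr .res := by simpa [hres₁] using hf₂.arr .res rfl
    have hchild₂ : σ₂.arr .child = σ.arr .child := by simpa [hchild₁] using hf₂.arr .child rfl
    have hopt₂ : σ₂.arr .opt = σ.arr .opt := by simpa [hopt₁] using hf₂.arr .opt rfl
    -- Round `j` examines the items from the end of the list, so item `i` is the last one not yet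
    -- decided.
    obtain ⟨i, hi⟩ : ∃ i, σ.reg .count - j = i + 1 := ⟨σ.reg .count - j - 1, by omega⟩
    have hi' : σ.reg .count - (j + 1) = i := by omega
    rw [hi] at hnot hsum
    refine wp_block_cons (wp_set ?_)
    simp only [Exp.eval, hcount₂, hrj, hi']
    refine wp_block_cons (wp_when (fun hb => ?_) fun hb => ?_)
    · simp only [Test.eval, Exp.eval, Memory.setReg_reg, Memory.setReg_arr, reduceCtorEq, if_true,
        if_false, hopt₂, hopt i (by omega) _ hw, hopt (i + 1) (by omega) _ hw,
        decide_eq_true_eq] at hb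
      rw [knap] at hb hsum
      split_ifs at hb hsum with hk
      · have hiC : σ.arr .child 0 i ∈ C := hC.mem i (by omega)
        refine wp_block_cons (wp_putVec (wp_block_cons (wp_set (wp_block_nil (wp_block_nil ?_)))))
        simp only [Exp.eval, Exp.vec, Memory.setReg_reg, Memory.setReg_arr, Memory.setCell_reg,
          reduceCtorEq, if_true, if_false, Memory.setCell_arr, false_and, hres₂, hchild₂, true_and]
        refine ⟨(Nat.sub_le _ _).trans hw, insert (σ.arr .child 0 i) S,
          insert_subset_iff.2 ⟨hiC, hSC⟩, fun x hx => ?_, fun k hk' => ?_, ?_⟩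
        · split_ifs with h
          · simp [h]
          · rw [hmark x hx, mem_insert]
            tauto
        · rw [mem_insert, not_or]
          refine ⟨fun h => ?_, hnot k (by omega)⟩
          have := hC.inj k (by omega) i (by omega) h
          omega
        · rw [sum_insert (hnot i (by omega)), ← hsum]
          simp only [itemSize]
          omega
      · omega
    · simp only [Test.eval, Exp.eval, Memory.setReg_reg, Memory.setReg_arr, reduceCtorEq, if_true,
        if_false, hopt₂, hopt i (by omega) _ hw, hopt (i + 1) (by omega) _ hw,
        decide_eq_false_iff_not, not_lt] at hb
      refine wp_block_nil ?_
      simp only [Memory.setReg_reg, Memory.setReg_arr, reduceCtorEq, if_false]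
      refine ⟨hw, S, hSC, hmark, fun k hk => hnot k (by omega), ?_⟩
      rw [← hsum]
      rw [knap] at hb ⊢
      split_ifs at hb ⊢
      · omega
      · rfl
  · rintro σ₂ hf₂ ⟨hw, S, hSC, hmark, -, hsum⟩
    refine wp_block_nil ⟨S, hSC, hmark, ?_⟩
    simpa [knap] using hsum

/-- Round `j` starts from marked vertices of label `j`, that is, of depth `j - 1`, and marks their
children at depth `j`. Round `0` is idle because labels are positive. -/
theorem wp_markSuccessors (hT : Rooted n a r par dep) (hN : n ≤ N) (hn : σ.reg .n = n)
    (ha : σ.arr .adj = a) (hl : ∀ x < n, σ.arr .label 0 x = dep x + 1) {S : Set ℕ}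
    (hS : ∀ x < n, σ.arr .mark 0 x = 1 ↔ x ∈ S) :
    Wp N markSuccessors (fun σ' => ∀ x < n, σ'.arr .mark 0 x = 1 ↔ Below n r par S x) σ := by
  refine wp_forTo (fun j σ' => ∀ z < n, σ'.arr .mark 0 z = 1 ↔
    z ∈ S ∨ (Below n r par S z ∧ dep z < j)) n hN rfl ?_ ?_ ?_ ?_
  · simpa using hS
  · intro k σ' hf _
    simpa [Exp.eval, hn] using hf.reg .n rfl
  · intro j hj σ₂ hf₂ hrj hI₂
    have hn₂ : σ₂.reg .n = n := by simpa [hn] using hf₂.reg .n rfl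
    have ha₂ : σ₂.arr .adj = a := by simpa [ha] using hf₂.arr .adj rfl
    have hl₂ : σ₂.arr .label = σ.arr .label := hf₂.arr .label rfl
    refine wp_block_cons ?_
    refine wp_forTo (fun k σ' => ∀ z < n, σ'.arr .mark 0 z = 1 ↔
      z ∈ S ∨ (Below n r par S z ∧ (dep z < j ∨ dep z = j ∧ z ≠ r ∧ par z < k)))
      n hN rfl ?_ ?_ ?_ ?_
    · simpa using hI₂
    · intro k σ' hf _
      simpa [Exp.eval, hn₂] using hf.reg .n rfl
    · intro x hx σ₃ hf₃ hrx hI₃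
      have hn₃ : σ₃.reg .n = n := by simpa [hn₂] using hf₃.reg .n rfl
      have ha₃ : σ₃.arr .adj = a := by simpa [ha₂] using hf₃.arr .adj rfl
      have hl₃ : σ₃.arr .label = σ.arr .label := (hf₃.arr .label rfl).trans hl₂
      have hj₃ : σ₃.reg .j = j := by simpa [Memory.setReg_reg, hrj] using hf₃.reg .j rfl
      refine wp_block_cons (wp_when (fun hb => ?_) fun hb => ?_)
      · simp only [Test.eval, Exp.vec, Exp.eval, hrx, hj₃, hl₃, hl x hx, Bool.and_eq_true,
          decide_eq_true_eq] at hb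
        rw [hI₃ x hx] at hb
        obtain ⟨hdx, hb⟩ := hb
        have hbx : Below n r par S x := hb.elim (fun h => .base hx h) (·.1)
        refine wp_block_cons ?_
        refine wp_forTo (fun k σ' => ∀ z < n, σ'.arr .mark 0 z = 1 ↔
          z ∈ S ∨ (Below n r par S z ∧ (dep z < j ∨ dep z = j ∧ z ≠ r ∧
            (par z < x ∨ par z = x ∧ z < k)))) n hN rfl ?_ ?_ ?_ ?_
        · simpa using hI₃
        · intro k σ' hf _
          simpa [Exp.eval, hn₃] using hf.reg .n rfl
        · intro y hy σ₄ hf₄ hry hI₄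
          have ha₄ : σ₄.arr .adj = a := by simpa [ha₃] using hf₄.arr .adj rfl
          have hl₄ : σ₄.arr .label = σ.arr .label := (hf₄.arr .label rfl).trans hl₃
          have hj₄ : σ₄.reg .j = j := by simpa [Memory.setReg_reg, hj₃] using hf₄.reg .j rfl
          have hx₄ : σ₄.reg .x = x := by simpa [Memory.setReg_reg, hrx] using hf₄.reg .x rfl
          have hcond : (a x y = 1 ∧ dep y + 1 = j + 1) ↔ dep y = j ∧ y ≠ r ∧ par y = x := by
            have := hT.mem_children_iff hx hy
            rw [mem_children] at this
            constructor
            · rintro ⟨h₁, h₂⟩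
              have := this.2 ⟨h₁, by omega⟩
              exact ⟨by omega, this.2⟩
            · rintro ⟨h₁, h₂⟩
              have := this.1 ⟨hy, h₂⟩
              exact ⟨this.1, by omega⟩
          refine wp_block_cons (wp_when (fun hb => ?_) fun hb => ?_)
          · simp only [Test.eval, Exp.vec, Exp.eval, hx₄, hry, ha₄, hl₄, hl y hy, hj₄,
              decide_eq_true_eq, Bool.and_eq_true] at hb
            rw [hcond] at hb
            refine wp_block_cons (wp_putVec (wp_block_nil (wp_block_nil ?_)))
            intro z hz'
            simp only [Memory.setReg_arr, Memory.setCell_arr, Exp.eval, hry, true_and]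
            by_cases hzy : z = y
            · subst hzy
              simp only [if_true, true_iff]
              exact .inr ⟨.step hz' hb.2.1 (hb.2.2 ▸ hbx),
                .inr ⟨hb.1, hb.2.1, .inr ⟨hb.2.2, by omega⟩⟩⟩
            · rw [if_neg hzy, hI₄ z hz']
              have : z < y + 1 ↔ z < y := by omega
              rw [this]
          · refine wp_block_nil ?_
            simp only [Test.eval, Exp.vec, Exp.eval, hx₄, hry, ha₄, hl₄, hl y hy, hj₄,
              ← Bool.not_eq_true, decide_eq_true_eq, Bool.and_eq_true] at hb
            rw [hcond] at hb
            intro z hz'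
            rw [Memory.setReg_arr, hI₄ z hz']
            by_cases hzy : z = y
            · subst hzy
              refine or_congr_right (and_congr_right fun _ => or_congr_right (and_congr_right
                fun h₁ => and_congr_right fun h₂ => or_congr_right ?_))
              exact ⟨fun h => absurd h.2 (by omega), fun h => absurd ⟨h₁, h₂, h.1⟩ hb⟩
            · have : z < y + 1 ↔ z < y := by omega
              rw [this]
        · intro σ₄ hf₄ hI₄
          refine wp_block_nil (wp_block_nil ?_)
          intro z hz'
          rw [Memory.setReg_arr, hI₄ z hz']
          have : par z < x + 1 ↔ (par z < x ∨ par z = x ∧ z < n) := by omega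
          rw [this]
      · refine wp_block_nil ?_
        simp only [Test.eval, Exp.vec, Exp.eval, hrx, hj₃, hl₃, hl x hx, ← Bool.not_eq_true,
          Bool.and_eq_true, decide_eq_true_eq] at hb
        rw [hI₃ x hx] at hb
        intro z hz'
        rw [Memory.setReg_arr, hI₃ z hz']
        constructor
        · rintro (h | ⟨h, h' | ⟨h₁, h₂, h₃⟩⟩)
          · exact .inl h
          · exact .inr ⟨h, .inl h'⟩
          · exact .inr ⟨h, .inr ⟨h₁, h₂, by omega⟩⟩
        · rintro (h | ⟨h, h' | ⟨h₁, h₂, h₃⟩⟩)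
          · exact .inl h
          · exact .inr ⟨h, .inl h'⟩
          · rcases Nat.lt_succ_iff_lt_or_eq.1 h₃ with h₃ | h₃
            · exact .inr ⟨h, .inr ⟨h₁, h₂, h₃⟩⟩
            -- If `z` is not itself in `S`, then its parent `x` is at or below `S` at depth `j - 1`,
            -- hence already marked, contrary to the failed test.
            · rcases (below_iff hz').1 h with h | ⟨-, h⟩
              · exact .inl h
              · have hd := hT.dep_par z hz' h₂
                rw [h₃] at h hd
                exact absurd ⟨by omega, .inr ⟨h, .inl (by omega)⟩⟩ hb
    · intro σ₃ hf₃ hI₃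
      refine wp_block_nil ?_
      intro z hz'
      rw [Memory.setReg_arr, hI₃ z hz']
      constructor
      · rintro (h | ⟨h, h'⟩)
        · exact .inl h
        · exact .inr ⟨h, by omega⟩
      · rintro (h | ⟨h, h'⟩)
        · exact .inl h
        · rcases (below_iff hz').1 h with h₁ | ⟨hr, h₁⟩
          · exact .inl h₁
          · have := hT.par_lt z hz' hr
            exact .inr ⟨h, by omega⟩
  · intro σ₂ hf₂ hI₂ z hz'
    rw [hI₂ z hz']
    constructor
    · rintro (h | h)
      · exact .base hz' h
      · exact h.1
    · exact fun h => .inr ⟨h, hT.dep_lt z hz'⟩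

end Knapsack

end MinMaxColoring

namespace MinMaxColoring

/-! ### Coloring the edges and treating a single vertex -/

section Candidate

open Finset

variable {n N r c : ℕ} {a : ℕ → ℕ → ℕ} {par dep : ℕ → ℕ} {σ : Memory Reg Arr}

/-- The matrix `m` gives the edge between `x` and its parent the color `f x`. -/
def Represents (n r : ℕ) (par : ℕ → ℕ) (m : ℕ → ℕ → ℕ) (f : ℕ → ℕ) : Prop :=
  ∀ x < n, x ≠ r → m x (par x) = f x ∧ m (par x) x = f x

theorem ite_ite_eq_ite_or (p q : Prop) [Decidable p] [Decidable q] (k t : ℕ) :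
    (if p then k else if q then k else t) = if p ∨ q then k else t := by
  split_ifs <;> simp_all

/-- The marked set is closed under descendants, so an edge colored from its upper end also has a
marked lower end. The invariant concerns the edge above `z`: its two entries agree, it either keeps
its color or passes from `0` to `K` with `z` at or below `S`, and it is colored once row `z` has
been scanned. -/
theorem wp_colorMarked (hT : Rooted n a r par dep) (hN : n ≤ N) (hn : σ.reg .n = n)
    (ha : σ.arr .adj = a) {S : Set ℕ} (hS : ∀ x < n, σ.arr .mark 0 x = 1 ↔ Below n r par S x)
    {col : ℕ → ℕ} (hcol : Represents n r par (σ.arr .cur) col) :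
    Wp N colorMarked (fun σ' => σ'.reg .color = σ.reg .color + 1 ∧
      Represents n r par (σ'.arr .cur) (recolor n r par col S (σ.reg .color + 1))) σ := by
  set K := σ.reg .color + 1 with hK
  refine wp_block_cons (wp_set (wp_block_cons ?_))
  simp only [Exp.eval, ← hK]
  refine wp_forTo (fun k σ' => ∀ z < n, z ≠ r →
    σ'.arr .cur z (par z) = σ'.arr .cur (par z) z ∧ (σ'.arr .cur z (par z) = col z ∨
      (col z = 0 ∧ Below n r par S z ∧ σ'.arr .cur z (par z) = K)) ∧
    (z < k → Below n r par S z → σ'.arr .cur z (par z) ≠ 0)) n hN rfl ?_ ?_ ?_ ?_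
  · intro z hz hzr
    simp only [Memory.setReg_arr, (hcol z hz hzr).1, (hcol z hz hzr).2]
    exact ⟨trivial, .inl trivial, by omega⟩
  · intro k σ' hf _
    simpa [Exp.eval, Memory.setReg_reg, hn] using hf.reg .n rfl
  · intro x hx σ₂ hf₂ hrx hI₂
    have hn₂ : σ₂.reg .n = n := by simpa [Memory.setReg_reg, hn] using hf₂.reg .n rfl
    have ha₂ : σ₂.arr .adj = a := by simpa [ha] using hf₂.arr .adj rfl
    have hm₂ : σ₂.arr .mark = σ.arr .mark := by simpa using hf₂.arr .mark rfl
    have hK₂ : σ₂.reg .color = K := by simpa [Memory.setReg_reg] using hf₂.reg .color rfl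
    refine wp_block_cons (wp_when (fun hb => ?_) fun hb => ?_)
    · simp only [Test.eval, Exp.vec, Exp.eval, hrx, hm₂, decide_eq_true_eq] at hb
      rw [hS x hx] at hb
      refine wp_block_cons ?_
      refine wp_forTo (fun k σ' => ∀ z < n, z ≠ r →
        σ'.arr .cur z (par z) = σ'.arr .cur (par z) z ∧ (σ'.arr .cur z (par z) = col z ∨
          (col z = 0 ∧ Below n r par S z ∧ σ'.arr .cur z (par z) = K)) ∧
        (z < x ∨ (z = x ∧ par z < k) → Below n r par S z → σ'.arr .cur z (par z) ≠ 0))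
        n hN rfl ?_ ?_ ?_ ?_
      · intro z hz hzr
        simpa using hI₂ z hz hzr
      · intro k σ' hf _
        simpa [Exp.eval, hn₂] using hf.reg .n rfl
      · intro y hy σ₃ hf₃ hry hI₃
        have ha₃ : σ₃.arr .adj = a := by simpa [ha₂] using hf₃.arr .adj rfl
        have hx₃ : σ₃.reg .x = x := by simpa [Memory.setReg_reg, hrx] using hf₃.reg .x rfl
        have hK₃ : σ₃.reg .color = K := by
          simpa [Memory.setReg_reg, hK₂] using hf₃.reg .color rfl
        refine wp_block_cons (wp_when (fun hb' => ?_) fun hb' => ?_)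
        · simp only [Test.eval, Exp.eval, hx₃, hry, ha₃, decide_eq_true_eq,
            Bool.and_eq_true] at hb'
          refine wp_block_cons (wp_put (wp_block_cons (wp_put (wp_block_nil (wp_block_nil ?_)))))
          intro z hz hzr
          simp only [Memory.setReg_arr, Memory.setCell_arr, Memory.setCell_reg, Exp.eval, hx₃, hry,
            hK₃, true_and, ite_ite_eq_ite_or]
          have hIz := hI₃ z hz hzr
          -- The edge just colored may be the one above `x` or the one above `y`.
          by_cases hzc : (z = x ∧ par z = y) ∨ (z = y ∧ par z = x)
          · have h0 : σ₃.arr .cur z (par z) = 0 := by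
              rcases hzc with ⟨rfl, rfl⟩ | ⟨rfl, rfl⟩
              · exact hb'.2
              · rw [hIz.1]; exact hb'.2
            have hbz : Below n r par S z := by
              rcases hzc with ⟨rfl, rfl⟩ | ⟨rfl, rfl⟩
              · exact hb
              · exact .step hz hzr hb
            rw [if_pos hzc.symm, if_pos (hzc.imp And.symm And.symm)]
            exact ⟨rfl, .inr ⟨by omega, hbz, rfl⟩, by omega⟩
          · rw [if_neg fun h => hzc h.symm, if_neg fun h => hzc (h.imp And.symm And.symm)]
            exact ⟨hIz.1, hIz.2.1, fun h => hIz.2.2 (by omega)⟩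
        · simp only [Test.eval, Exp.eval, hx₃, hry, ha₃, decide_eq_true_eq,
            Bool.and_eq_true, ← Bool.not_eq_true] at hb'
          refine wp_block_nil fun z hz hzr => ?_
          have hIz := hI₃ z hz hzr
          refine ⟨hIz.1, hIz.2.1, fun h hbz => ?_⟩
          by_cases hzc : z = x ∧ par z = y
          · obtain ⟨rfl, rfl⟩ := hzc
            exact fun h0 => hb' ⟨(hT.adj_iff z hz _ hy).2 (.inl ⟨hzr, rfl⟩), h0⟩
          · exact hIz.2.2 (by omega) hbz
      · intro σ₃ hf₃ hI₃
        refine wp_block_nil (wp_block_nil fun z hz hzr => ?_)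
        have hIz := hI₃ z hz hzr
        have := hT.par_lt z hz hzr
        exact ⟨hIz.1, hIz.2.1, fun h => hIz.2.2 (by omega)⟩
    · refine wp_block_nil fun z hz hzr => ?_
      simp only [Test.eval, Exp.vec, Exp.eval, hrx, hm₂, decide_eq_false_iff_not] at hb
      rw [hS x hx] at hb
      have hIz := hI₂ z hz hzr
      refine ⟨hIz.1, hIz.2.1, fun h hbz => hIz.2.2 ?_ hbz⟩
      have : z ≠ x := by rintro rfl; exact hb hbz
      omega
  · intro σ₂ hf₂ hI₂
    refine wp_block_nil ⟨by simpa [Memory.setReg_reg] using hf₂.reg .color rfl, fun z hz hzr => ?_⟩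
    have hIz := hI₂ z hz hzr
    rw [← hIz.1, and_self, recolor]
    split_ifs with h
    · have := hIz.2.2 hz h.2
      rcases hIz.2.1 with h' | h'
      · exact absurd (h'.trans h.1) this
      · exact h'.2.2
    · rcases hIz.2.1 with h' | h'
      · exact h'
      · exact absurd ⟨h'.1, h'.2.1⟩ h

theorem wp_colorRemaining (hN : n ≤ N) (hn : σ.reg .n = n) (ha : σ.arr .adj = a) :
    Wp N colorRemaining (fun σ' => ∀ x < n, ∀ y < n, a x y = 1 → σ'.arr .cur x y =
      if σ.arr .cur x y = 0 then σ.reg .color + 1 else σ.arr .cur x y) σ := by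
  set K := σ.reg .color + 1 with hK
  refine wp_block_cons (wp_set (wp_block_cons ?_))
  simp only [Exp.eval, ← hK]
  refine wp_forTo (fun k σ' => ∀ x < n, ∀ y < n, a x y = 1 → σ'.arr .cur x y =
    if x < k ∧ σ.arr .cur x y = 0 then K else σ.arr .cur x y) n hN rfl (by simp) ?_ ?_ ?_
  · intro k σ' hf _
    simpa [Exp.eval, Memory.setReg_reg, hn] using hf.reg .n rfl
  · intro x hx σ₂ hf₂ hrx hI₂
    have hn₂ : σ₂.reg .n = n := by simpa [Memory.setReg_reg, hn] using hf₂.reg .n rfl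
    have ha₂ : σ₂.arr .adj = a := by simpa [ha] using hf₂.arr .adj rfl
    have hK₂ : σ₂.reg .color = K := by simpa [Memory.setReg_reg] using hf₂.reg .color rfl
    refine wp_block_cons ?_
    refine wp_forTo (fun k σ' => ∀ x' < n, ∀ y < n, a x' y = 1 → σ'.arr .cur x' y =
      if (x' < x ∨ x' = x ∧ y < k) ∧ σ.arr .cur x' y = 0 then K else σ.arr .cur x' y)
      n hN rfl ?_ ?_ ?_ ?_
    · simpa using hI₂
    · intro k σ' hf _
      simpa [Exp.eval, hn₂] using hf.reg .n rfl
    · intro y hy σ₃ hf₃ hry hI₃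
      have ha₃ : σ₃.arr .adj = a := by simpa [ha₂] using hf₃.arr .adj rfl
      have hx₃ : σ₃.reg .x = x := by simpa [Memory.setReg_reg, hrx] using hf₃.reg .x rfl
      have hK₃ : σ₃.reg .color = K := by simpa [Memory.setReg_reg, hK₂] using hf₃.reg .color rfl
      refine wp_block_cons (wp_when (fun hb => ?_) fun hb => ?_)
      · simp only [Test.eval, Exp.eval, hx₃, hry, ha₃, decide_eq_true_eq, Bool.and_eq_true] at hb
        -- The pair `(x, y)` has not been visited yet, so its entry is still the initial one.
        have h0 := hI₃ x hx y hy hb.1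
        rw [hb.2, if_neg (by omega)] at h0
        refine wp_block_cons (wp_put (wp_block_nil (wp_block_nil ?_)))
        intro x' hx' y' hy' hxy
        simp only [Memory.setReg_arr, Memory.setCell_arr, Exp.eval, hx₃, hry, hK₃, true_and]
        by_cases h : x' = x ∧ y' = y
        · rw [if_pos h, if_pos]
          rw [h.1, h.2]
          exact ⟨by omega, h0.symm⟩
        · rw [if_neg h, hI₃ x' hx' y' hy' hxy]
          refine if_congr ?_ rfl rfl
          have : (x' < x ∨ x' = x ∧ y' < y) ↔ (x' < x ∨ x' = x ∧ y' < y + 1) := by omega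
          rw [this]
      · simp only [Test.eval, Exp.eval, hx₃, hry, ha₃, decide_eq_true_eq, Bool.and_eq_true,
          ← Bool.not_eq_true] at hb
        refine wp_block_nil ?_
        intro x' hx' y' hy' hxy
        rw [Memory.setReg_arr, hI₃ x' hx' y' hy' hxy]
        refine if_congr ?_ rfl rfl
        by_cases h : x' = x ∧ y' = y
        · obtain ⟨rfl, rfl⟩ := h
          have h0 := hI₃ x' hx' y' hy' hxy
          rw [if_neg (by omega)] at h0
          have : σ.arr .cur x' y' ≠ 0 := fun h => hb ⟨hxy, h0.trans h⟩
          simp [this]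
        · have : (x' < x ∨ x' = x ∧ y' < y) ↔ (x' < x ∨ x' = x ∧ y' < y + 1) := by omega
          rw [this]
    · intro σ₃ hf₃ hI₃
      refine wp_block_nil ?_
      intro x' hx' y hy hxy
      rw [Memory.setReg_arr, hI₃ x' hx' y hy hxy]
      refine if_congr ?_ rfl rfl
      have : (x' < x ∨ x' = x ∧ y < n) ↔ x' < x + 1 := by omega
      rw [this]
  · intro σ₂ hf₂ hI₂
    refine wp_block_nil ?_
    intro x hx y hy hxy
    rw [hI₂ x hx y hy hxy]
    simp [hx]

/-- What is known during a test of the candidate `c` when the vertices in `P` have been treated. -/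
structure TestInv (n r : ℕ) (par : ℕ → ℕ) (c : ℕ) (P : Set ℕ) (σ : Memory Reg Arr) : Prop where
  complete : ∀ f, Valid n r par c f → σ.reg .ok = 1 ∧
    ∀ x < n, σ.arr .res 0 x ≤ #(colored n r par f (f x) x)
  sound : σ.reg .ok = 1 → ∃ col, Partial n r par c P (σ.arr .res 0) col ∧
    Represents n r par (σ.arr .cur) col ∧ ∀ x < n, col x ≤ σ.reg .color

theorem TestInv.congr {P : Set ℕ} {σ' : Memory Reg Arr} (h : TestInv n r par c P σ)
    (hok : σ'.reg .ok = σ.reg .ok) (hcolor : σ'.reg .color = σ.reg .color)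
    (hres : σ'.arr .res = σ.arr .res) (hcur : σ'.arr .cur = σ.arr .cur) :
    TestInv n r par c P σ' := by
  constructor
  · rw [hok, hres]; exact h.complete
  · rw [hok, hres, hcolor, hcur]; exact h.sound

/-- After a failure the soundness clause is void, so the set of treated vertices no longer matters.
-/
theorem TestInv.of_fail {P P' : Set ℕ} (h : TestInv n r par c P σ) (hok : σ.reg .ok ≠ 1) :
    TestInv n r par c P' σ :=
  ⟨h.complete, fun h => absurd h hok⟩

/-- The parts of the memory that stay the same during a test. -/
structure Setting (n : ℕ) (a : ℕ → ℕ → ℕ) (dep : ℕ → ℕ) (c : ℕ) (σ : Memory Reg Arr) : Prop where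
  reg_n : σ.reg .n = n
  adj : σ.arr .adj = a
  label : ∀ x < n, σ.arr .label 0 x = dep x + 1
  reg_c : σ.reg .c = c

theorem Setting.frame {p : Cmd Reg Arr} {σ' : Memory Reg Arr} (h : Setting n a dep c σ)
    (hf : Frame p σ σ') (h₁ : p.setsReg .n = false) (h₂ : p.setsArr .adj = false)
    (h₃ : p.setsArr .label = false) (h₄ : p.setsReg .c = false) : Setting n a dep c σ' where
  reg_n := (hf.reg .n h₁).trans h.reg_n
  adj := (hf.arr .adj h₂).trans h.adj
  label := by rw [hf.arr .label h₃]; exact h.label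
  reg_c := (hf.reg .c h₄).trans h.reg_c

theorem recolor_empty (col : ℕ → ℕ) (K : ℕ) : recolor n r par col ∅ K = col := by
  funext x
  have : ¬ Below n r par ∅ x := fun h => by simpa using h.exists_mem
  simp [recolor, this]

/-- Both halves of the argument meet here: `Rooted.residual_le` places the new residual number below
a color group of every solution, so a value above `c` rules out all solutions; otherwise
`Partial.treat` extends the partial coloring. -/
theorem wp_processVertex (hT : Rooted n a r par dep) (hN : n ≤ N) (hcN : c + 1 ≤ N)
    (hσ : Setting n a dep c σ) {P : Set ℕ} (hP : ∀ x < n, x ≠ r → par x ∈ P → x ∈ P)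
    {v : ℕ} (hv : v < n) (hvP : v ∉ P) (hch : ∀ w ∈ children n r par v, w ∈ P)
    (hrv : σ.reg .v = v) (hd : σ.reg .d = dep v + 1) (hok : σ.reg .ok = 1)
    (hI : TestInv n r par c P σ) :
    Wp N processVertex (TestInv n r par c (insert v P)) σ := by
  obtain ⟨col, hpart, hrep, hcol⟩ := hI.sound hok
  have hresv := hpart.res_eq v hv hvP
  refine wp_block_cons ((wp_listChildren hT hN hσ.reg_n hσ.adj hσ.label hv hrv hd).mono ?_)
  rintro σ₁ hf₁ ⟨hL, htot⟩
  have hσ₁ := hσ.frame hf₁ rfl rfl rfl rfl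
  have hok₁ : σ₁.reg .ok = σ.reg .ok := hf₁.reg .ok rfl
  have hcolor₁ : σ₁.reg .color = σ.reg .color := hf₁.reg .color rfl
  have hv₁ : σ₁.reg .v = v := (hf₁.reg .v rfl).trans hrv
  have hres₁ : σ₁.arr .res = σ.arr .res := hf₁.arr .res rfl
  have hcur₁ : σ₁.arr .cur = σ.arr .cur := hf₁.arr .cur rfl
  have hI₁ := hI.congr hok₁ hcolor₁ hres₁ hcur₁
  have hcountN : σ₁.reg .count ≤ N := by
    rw [hL.count_eq]
    refine (card_filter_le _ _).trans ?_
    rwa [card_range]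
  refine wp_block_cons (wp_when (fun hb => ?_) fun hb => wp_block_nil ?_)
  swap
  · have hC : children n r par v = ∅ := by
      simpa [Test.eval, Exp.eval, hL.count_eq] using hb
    refine ⟨hI₁.complete, fun _ => ⟨col, ?_, hcur₁ ▸ hrep, hcolor₁ ▸ hcol⟩⟩
    -- At a leaf nothing is selected, so recoloring changes nothing and the fresh color is never
    -- used.
    have := hpart.treat hT hP (K := σ.reg .color + 1) (B := 0) hv hvP hch (empty_subset _)
      (by simp) (by omega) (fun x hx => by have := hcol x hx; omega) (by simp)
      (by rw [hC]; simpa using hpart.res_le v hv)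
    simpa [hC, recolor_empty, hres₁] using this
  refine wp_block_cons ((wp_solveKnapsack hσ₁.reg_c hcN hcountN).mono fun σ₂ hf₂ hopt => ?_)
  have hσ₂ := hσ₁.frame hf₂ rfl rfl rfl rfl
  have hok₂ : σ₂.reg .ok = σ.reg .ok := (hf₂.reg .ok rfl).trans hok₁
  have hcolor₂ : σ₂.reg .color = σ.reg .color := (hf₂.reg .color rfl).trans hcolor₁
  have hv₂ : σ₂.reg .v = v := (hf₂.reg .v rfl).trans hv₁
  have hcount₂ : σ₂.reg .count = σ₁.reg .count := hf₂.reg .count rfl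
  have htot₂ : σ₂.reg .total = _ := (hf₂.reg .total rfl).trans htot
  have hres₂ : σ₂.arr .res = σ.arr .res := (hf₂.arr .res rfl).trans hres₁
  have hcur₂ : σ₂.arr .cur = σ.arr .cur := (hf₂.arr .cur rfl).trans hcur₁
  have hchild₂ : σ₂.arr .child = σ₁.arr .child := hf₂.arr .child rfl
  have hL₂ : Lists σ₂ (children n r par v) := by
    constructor
    · rw [hcount₂]; exact hL.count_eq
    · rw [hcount₂, hchild₂]; exact hL.mem
    · rw [hcount₂, hchild₂]; exact hL.inj
  have hitem : itemSize σ₂ = itemSize σ₁ := by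
    funext i; simp [itemSize, hres₂, hres₁, hchild₂]
  rw [← hitem, ← hcount₂] at hopt
  set B := knap (itemSize σ₂) (σ₂.reg .count) c with hB
  have hBopt : σ₂.arr .opt (σ₂.reg .count) c = B := hopt _ le_rfl c le_rfl
  have hbest : ∀ S ⊆ children n r par v, ∑ w ∈ S, σ.arr .res 0 w ≤ c →
      ∑ w ∈ S, σ.arr .res 0 w ≤ B := by
    intro S hS hc
    rw [← hres₂] at hc ⊢
    exact hL₂.sum_le_knap hS hc
  have hlow : ∀ f, Valid n r par c f →
      (∑ w ∈ children n r par v, σ.arr .res 0 w - B) + σ.arr .res 0 v ≤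
        #(colored n r par f (f v) v) :=
    fun f hf => hT.residual_le hf (hI.complete f hf).2 hv hresv hbest
  refine wp_block_cons (wp_ite (fun hb => wp_set (wp_block_nil (wp_block_nil ?_))) fun hb => ?_)
  · simp only [Test.eval, Exp.eval, Exp.vec, hσ₂.reg_c, htot₂, hBopt, hres₂, hv₂,
      decide_eq_true_eq] at hb
    refine ⟨fun f hf => ?_, fun h => ?_⟩
    · have h₁ := hlow f hf
      have h₂ := hf.card_colored_le (f v) v
      omega
    · simp [Memory.setReg_reg, Exp.eval] at h
  simp only [Test.eval, Exp.eval, Exp.vec, hσ₂.reg_c, htot₂, hBopt, hres₂, hv₂,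
    decide_eq_false_iff_not, not_lt] at hb
  refine wp_block_cons ((wp_markSolution hN hσ₂.reg_n hσ₂.reg_c (hcount₂ ▸ hcountN) hL₂ hopt).mono
    ?_)
  rintro σ₃ hf₃ ⟨S, hS, hmark, hsum⟩
  rw [← hB, hres₂] at hsum
  have hσ₃ := hσ₂.frame hf₃ rfl rfl rfl rfl
  refine wp_block_cons ((wp_markSuccessors hT hN hσ₃.reg_n hσ₃.adj hσ₃.label (S := S) hmark).mono
    fun σ₄ hf₄ hmark₄ => ?_)
  have hσ₄ := hσ₃.frame hf₄ rfl rfl rfl rfl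
  have hcur₄ : σ₄.arr .cur = σ.arr .cur :=
    ((hf₄.arr .cur rfl).trans (hf₃.arr .cur rfl)).trans hcur₂
  have hcolor₄ : σ₄.reg .color = σ.reg .color :=
    ((hf₄.reg .color rfl).trans (hf₃.reg .color rfl)).trans hcolor₂
  refine wp_block_cons ((wp_colorMarked hT hN hσ₄.reg_n hσ₄.adj hmark₄ (hcur₄ ▸ hrep)).mono ?_)
  rintro σ₅ hf₅ ⟨hcolor₅, hrep₅⟩
  rw [hcolor₄] at hcolor₅ hrep₅
  have hσ₅ := hσ₄.frame hf₅ rfl rfl rfl rfl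
  have hres₅ : σ₅.arr .res = σ.arr .res :=
    (((hf₅.arr .res rfl).trans (hf₄.arr .res rfl)).trans (hf₃.arr .res rfl)).trans hres₂
  have hopt₅ : σ₅.arr .opt = σ₂.arr .opt :=
    ((hf₅.arr .opt rfl).trans (hf₄.arr .opt rfl)).trans (hf₃.arr .opt rfl)
  have hcount₅ : σ₅.reg .count = σ₂.reg .count :=
    ((hf₅.reg .count rfl).trans (hf₄.reg .count rfl)).trans (hf₃.reg .count rfl)
  have htot₅ : σ₅.reg .total = _ :=
    (((hf₅.reg .total rfl).trans (hf₄.reg .total rfl)).trans (hf₃.reg .total rfl)).trans htot₂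
  have hv₅ : σ₅.reg .v = v :=
    (((hf₅.reg .v rfl).trans (hf₄.reg .v rfl)).trans (hf₃.reg .v rfl)).trans hv₂
  have hok₅ : σ₅.reg .ok = 1 :=
    ((((hf₅.reg .ok rfl).trans (hf₄.reg .ok rfl)).trans (hf₃.reg .ok rfl)).trans hok₂).trans hok
  refine wp_block_cons (wp_putVec (wp_block_nil (wp_block_nil (wp_block_nil ?_))))
  simp only [Exp.eval, Exp.vec, hres₅, hv₅, htot₅, hcount₅, hopt₅, hσ₅.reg_c, hBopt]
  set R := ∑ w ∈ children n r par v, σ.arr .res 0 w - B with hR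
  have hnew : (σ₅.setCell .res 0 v (σ.arr .res 0 v + R)).arr .res 0 =
      Function.update (σ.arr .res 0) v (σ.arr .res 0 v + R) := by
    funext x
    simp [Memory.setCell_arr, Function.update_apply, hres₅]
  constructor
  · intro f hf
    refine ⟨hok₅, fun x hx => ?_⟩
    rw [hnew, Function.update_apply]
    split_ifs with h
    · have := hlow f hf
      rw [h]
      omega
    · exact (hI.complete f hf).2 x hx
  · intro _
    refine ⟨recolor n r par col S (σ.reg .color + 1), ?_, ?_, ?_⟩
    · rw [hnew]
      exact hpart.treat hT hP hv hvP hch hS (hsum ▸ knap_le _ _ _) (by omega)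
        (fun x hx => by have := hcol x hx; omega) hsum hb
    · rw [Memory.setCell_arr_ne _ _ _ _ _ _ (by decide)]
      exact hrep₅
    · intro x hx
      have := hcol x hx
      rw [Memory.setCell_reg, hcolor₅, recolor]
      split_ifs <;> omega

end Candidate

end MinMaxColoring

namespace MinMaxColoring

/-! ### Correctness of the test of one candidate -/

section Search

open Finset

variable {n N r c : ℕ} {a : ℕ → ℕ → ℕ} {par dep : ℕ → ℕ} {σ : Memory Reg Arr}

theorem TestInv.start (hc : 1 ≤ c) {P : Set ℕ} (hP : ∀ x < n, x ∉ P)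
    (hT : Rooted n a r par dep) (hok : σ.reg .ok = 1)
    (hres : ∀ x < n, σ.arr .res 0 x = if x = r then 0 else 1)
    (hcur : ∀ x < n, ∀ y < n, σ.arr .cur x y = 0) : TestInv n r par c P σ := by
  refine ⟨fun f hf => ⟨hok, fun x hx => ?_⟩, fun _ => ⟨fun _ => 0, .start hc hP hres, ?_, ?_⟩⟩
  · rw [hres x hx]
    split_ifs with h
    · exact Nat.zero_le _
    -- The initial residual number `1` is accounted for by the edge above `x` itself.
    · exact card_pos.2 ⟨x, mem_colored.2 ⟨hx, h, rfl, .base hx rfl⟩⟩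
  · intro x hx hr
    have := hT.par_lt x hx hr
    exact ⟨hcur x hx _ this, hcur _ this x hx⟩
  · exact fun _ _ => Nat.zero_le _

/-- A solution for the bound `c` has been written into the matrix `m`. -/
def Solution (n r : ℕ) (par : ℕ → ℕ) (c : ℕ) (m : ℕ → ℕ → ℕ) : Prop :=
  ∃ f, Valid n r par c f ∧ Represents n r par m f ∧ ∀ x < n, f x ≠ 0

theorem Solution.congr (hT : Rooted n a r par dep) {m m' : ℕ → ℕ → ℕ}
    (h : Solution n r par c m) (hm : ∀ x < n, ∀ y < n, m' x y = m x y) :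
    Solution n r par c m' := by
  obtain ⟨f, hf, hr, h0⟩ := h
  refine ⟨f, hf, fun x hx hxr => ?_, h0⟩
  have := hT.par_lt x hx hxr
  rw [hm x hx _ this, hm _ this x hx]
  exact hr x hx hxr

theorem wp_testCandidate (hT : Rooted n a r par dep) (hN : n ≤ N) (hn : σ.reg .n = n)
    (ha : σ.arr .adj = a) (hl : ∀ x < n, σ.arr .label 0 x = dep x + 1) (hr : σ.reg .root = r)
    (hc : (σ.reg .l + σ.reg .u) / 2 = c) (hc1 : 1 ≤ c) (hcN : c + 1 ≤ N) :
    Wp N testCandidate (fun σ' =>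
      (σ'.reg .u = c ∧ σ'.reg .l = σ.reg .l ∧ σ'.reg .stored = 1 ∧
        Solution n r par c (σ'.arr .U)) ∨
      ((∀ f, ¬ Valid n r par c f) ∧ σ'.reg .l = c + 1 ∧ σ'.reg .u = σ.reg .u ∧
        σ'.reg .stored = σ.reg .stored ∧ σ'.arr .U = σ.arr .U)) σ := by
  refine wp_block_cons ((wp_fill .res (fun σ => Exp.eval_one σ) hN hn).mono fun σ₁ hf₁ hres₁ => ?_)
  have hn₁ : σ₁.reg .n = n := (hf₁.reg .n rfl).trans hn
  have hr₁ : σ₁.reg .root = r := (hf₁.reg .root rfl).trans hr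
  have hl₁ : σ₁.reg .l = σ.reg .l := hf₁.reg .l rfl
  have hu₁ : σ₁.reg .u = σ.reg .u := hf₁.reg .u rfl
  refine wp_block_cons (wp_putVec (wp_block_cons (wp_set (wp_block_cons ?_))))
  simp only [Exp.eval, hr₁, Memory.setCell_reg, hl₁, hu₁, hc]
  set τ := (σ₁.setCell .res 0 r 0).setReg .c c with hτ
  have hnτ : τ.reg .n = n := by simp [hτ, Memory.setReg_reg, hn₁]
  refine (wp_fillMatrix (σ := τ) .cur (e := 0) (F := fun _ _ => 0) (fun _ _ => rfl) hN hnτ).mono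
    fun σ₂ hf₂ hcur₂ => ?_
  have hσ₂ : Setting n a dep c σ₂ := by
    refine Setting.frame (σ := τ) ⟨hnτ, ?_, ?_, by simp [hτ, Memory.setReg_reg]⟩ hf₂ rfl rfl rfl rfl
    · rw [hτ, Memory.setReg_arr, Memory.setCell_arr_ne _ _ _ _ _ _ (by decide)]
      exact (hf₁.arr .adj rfl).trans ha
    · rw [hτ, Memory.setReg_arr, Memory.setCell_arr_ne _ _ _ _ _ _ (by decide),
        hf₁.arr .label rfl]
      exact hl
  have hres₂ : ∀ x < n, σ₂.arr .res 0 x = if x = r then 0 else 1 := by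
    intro x hx
    rw [hf₂.arr .res rfl, hτ]
    simp only [Memory.setReg_arr, Memory.setCell_arr, true_and, hres₁ x hx]
  have hl₂ : σ₂.reg .l = σ.reg .l := by
    rw [hf₂.reg .l rfl, hτ]; simpa [Memory.setReg_reg] using hl₁
  have hu₂ : σ₂.reg .u = σ.reg .u := by
    rw [hf₂.reg .u rfl, hτ]; simpa [Memory.setReg_reg] using hu₁
  have hs₂ : σ₂.reg .stored = σ.reg .stored := by
    rw [hf₂.reg .stored rfl, hτ]; simpa [Memory.setReg_reg] using hf₁.reg .stored rfl
  have hU₂ : σ₂.arr .U = σ.arr .U := by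
    rw [hf₂.arr .U rfl, hτ, Memory.setReg_arr, Memory.setCell_arr_ne _ _ _ _ _ _ (by decide)]
    exact hf₁.arr .U rfl
  refine wp_block_cons (wp_set (wp_block_cons (wp_set (wp_block_cons ?_))))
  simp only [Exp.eval]
  set ρ := (σ₂.setReg .color 0).setReg .ok 1 with hρ
  have hρs : Setting n a dep c ρ :=
    ⟨by simp [hρ, Memory.setReg_reg, hσ₂.reg_n], hσ₂.adj, hσ₂.label,
      by simp [hρ, Memory.setReg_reg, hσ₂.reg_c]⟩
  -- Labels are at most `n` and round `k` treats label `n - k`; after `k` rounds the labels above `n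
  -- - k` are done, written here without subtraction.
  refine wp_forTo (fun k σ' => TestInv n r par c {x | n < dep x + 1 + k} σ') n hN rfl ?_ ?_ ?_ ?_
  · refine .start hc1 ?_ hT (by simp [hρ, Memory.setReg_reg]) hres₂ hcur₂
    intro x hx h
    have := hT.dep_lt x hx
    simp at h
    omega
  · intro k σ' hf _
    exact (hρs.frame hf rfl rfl rfl rfl).reg_n
  · intro k hk σ₃ hf₃ hrk hI₃
    have hσ₃ := hρs.frame hf₃ rfl rfl rfl rfl
    refine wp_block_cons (wp_set (wp_block_cons ?_))
    simp only [Exp.eval, hσ₃.reg_n, hrk]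
    have hσ₃' : Setting n a dep c (σ₃.setReg .d (n - k)) :=
      ⟨by simp [Memory.setReg_reg, hσ₃.reg_n], hσ₃.adj, hσ₃.label,
        by simp [Memory.setReg_reg, hσ₃.reg_c]⟩
    refine wp_forTo (fun v σ' => TestInv n r par c
      {x | n < dep x + 1 + k ∨ (n = dep x + 1 + k ∧ x < v)} σ') n hN rfl ?_ ?_ ?_ ?_
    · simpa using hI₃.congr (σ' := (σ₃.setReg .d (n - k)).setReg .v 0)
        (by simp [Memory.setReg_reg]) (by simp [Memory.setReg_reg]) rfl rfl
    · intro k σ' hf _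
      exact (hσ₃'.frame hf rfl rfl rfl rfl).reg_n
    · intro v hv σ₄ hf₄ hrv hI₄
      have hσ₄ := hσ₃'.frame hf₄ rfl rfl rfl rfl
      have hd₄ : σ₄.reg .d = n - k := by simpa [Memory.setReg_reg] using hf₄.reg .d rfl
      refine wp_block_cons (wp_when (fun hb => ?_) fun hb => wp_block_nil ?_)
      · simp only [Test.eval, Exp.eval, Exp.vec, hrv, hσ₄.label v hv, hd₄, Bool.and_eq_true,
          decide_eq_true_eq] at hb
        refine wp_block_cons ((wp_processVertex hT hN hcN hσ₄ ?_ hv ?_ ?_ hrv (by omega)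
          (of_decide_eq_true hb.2) hI₄).mono fun σ₅ hf₅ hI₅ => wp_block_nil (wp_block_nil ?_))
        · intro x hx hxr h
          have := hT.dep_par x hx hxr
          simp only [Set.mem_ofPred_eq] at h ⊢
          omega
        · simp only [Set.mem_ofPred_eq]
          omega
        · intro w hw
          have := hT.dep_child hw
          simp only [Set.mem_ofPred_eq]
          omega
        · have hset : insert v {x | n < dep x + 1 + k ∨ (n = dep x + 1 + k ∧ x < v)} =
              {x | n < dep x + 1 + k ∨ (n = dep x + 1 + k ∧ x < v + 1)} := by
            ext x
            simp only [Set.mem_insert_iff, Set.mem_ofPred_eq]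
            constructor
            · rintro (rfl | h)
              · exact .inr ⟨by omega, by omega⟩
              · omega
            · omega
          rw [hset] at hI₅
          exact hI₅.congr (by simp [Memory.setReg_reg]) (by simp [Memory.setReg_reg]) rfl rfl
      · have hI₄' := hI₄.congr (σ' := σ₄.setReg .v (v + 1)) (by simp [Memory.setReg_reg])
          (by simp [Memory.setReg_reg]) rfl rfl
        simp only [Test.eval, Exp.eval, Exp.vec, hrv, hσ₄.label v hv, hd₄, ← Bool.not_eq_true,
          Bool.and_eq_true, decide_eq_true_eq, not_and_or] at hb
        rcases hb with hb | hb
        · have hset : {x | n < dep x + 1 + k ∨ (n = dep x + 1 + k ∧ x < v)} =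
              {x | n < dep x + 1 + k ∨ (n = dep x + 1 + k ∧ x < v + 1)} := by
            ext x
            simp only [Set.mem_ofPred_eq]
            constructor
            · omega
            · rintro (h | ⟨h, h'⟩)
              · exact .inl h
              · refine .inr ⟨h, ?_⟩
                have : x ≠ v := by rintro rfl; omega
                omega
          exact hset ▸ hI₄'
        · exact hI₄'.of_fail fun h => hb (decide_eq_true (by simpa [Memory.setReg_reg] using h))
    · intro σ₄ hf₄ hI₄
      refine wp_block_nil ?_
      have hI₄' := hI₄.congr (σ' := σ₄.setReg .k (k + 1)) (by simp [Memory.setReg_reg])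
          (by simp [Memory.setReg_reg]) rfl rfl
      refine ⟨hI₄'.complete, fun h => ?_⟩
      obtain ⟨col, hp, hcol⟩ := hI₄'.sound h
      -- The treated sets at the end of this round and at the start of the next agree only on
      -- numbers below `n`, so the fields are transported one by one.
      refine ⟨col, ⟨fun x hx hxP => hp.res_eq x hx fun h => hxP ?_, hp.res_le, hp.col_root,
        fun x hx hxr hxP => hp.uncolored x hx hxr fun h => hxP ?_, hp.group,
        fun v hv hvP => hp.two v hv ?_, fun v hv hvP => hp.card_uncolored v hv ?_⟩, hcol⟩ <;>
        simp only [Set.mem_ofPred_eq] at * <;> omega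
  · intro σ₃ hf₃ hI₃
    have hσ₃ := hρs.frame hf₃ rfl rfl rfl rfl
    have hl₃ : σ₃.reg .l = σ.reg .l := by
      rw [hf₃.reg .l rfl, hρ]; simpa [Memory.setReg_reg] using hl₂
    have hu₃ : σ₃.reg .u = σ.reg .u := by
      rw [hf₃.reg .u rfl, hρ]; simpa [Memory.setReg_reg] using hu₂
    have hs₃ : σ₃.reg .stored = σ.reg .stored := by
      rw [hf₃.reg .stored rfl, hρ]; simpa [Memory.setReg_reg] using hs₂
    have hU₃ : σ₃.arr .U = σ.arr .U := (hf₃.arr .U rfl).trans hU₂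
    refine wp_block_cons (wp_ite (fun hb => ?_) fun hb => wp_set (wp_block_nil (.inr ?_)))
    · obtain ⟨col, hp, hrep, hcol⟩ := hI₃.sound (of_decide_eq_true hb)
      refine wp_block_cons ((wp_colorRemaining hN hσ₃.reg_n hσ₃.adj).mono fun σ₄ hf₄ hcur₄ => ?_)
      have hσ₄ := hσ₃.frame hf₄ rfl rfl rfl rfl
      refine wp_block_cons ((wp_copyColoring (by decide) hN hσ₄.reg_n).mono fun σ₅ hf₅ hU₅ => ?_)
      have hσ₅ := hσ₄.frame hf₅ rfl rfl rfl rfl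
      have hl₅ : σ₅.reg .l = σ.reg .l := ((hf₅.reg .l rfl).trans (hf₄.reg .l rfl)).trans hl₃
      refine wp_block_cons (wp_set (wp_block_cons (wp_set (wp_block_nil (wp_block_nil (.inl ?_))))))
      simp only [Memory.setReg_reg, Memory.setReg_arr, Exp.eval, reduceCtorEq, if_true, if_false,
        hσ₅.reg_c, hl₅, true_and]
      refine ⟨_, hp.valid hT (K := σ₃.reg .color + 1) (fun x hx => ?_)
        (fun x hx => by have := hcol x hx; omega), fun x hx hxr => ?_, fun x hx => ?_⟩
      · simp only [Set.mem_ofPred_eq]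
        omega
      · have hpx := hT.par_lt x hx hxr
        have hax := (hT.adj_iff x hx _ hpx).2 (.inl ⟨hxr, rfl⟩)
        have hax' := (hT.adj_symm hx hpx).1 hax
        rw [hU₅ x hx _ hpx, hU₅ _ hpx x hx, hcur₄ x hx _ hpx hax, hcur₄ _ hpx x hx hax',
          (hrep x hx hxr).1, (hrep x hx hxr).2]
        exact ⟨rfl, rfl⟩
      · split_ifs with h <;> omega
    · simp only [Memory.setReg_reg, Memory.setReg_arr, Exp.eval, reduceCtorEq, if_true, if_false,
        hσ₃.reg_c, hu₃, hs₃, hU₃, and_true]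
      -- A single solution for `c` would have kept `ok` equal to `1`.
      exact fun f hf => of_decide_eq_false hb (hI₃.complete f hf).1

end Search

end MinMaxColoring

namespace MinMaxColoring

/-! ### Bounds from the maximum degree, bisection, and the whole program -/

section Main

open Finset

variable {n N r c Δ : ℕ} {a : ℕ → ℕ → ℕ} {par dep : ℕ → ℕ} {σ : Memory Reg Arr}

theorem Valid.mono {f : ℕ → ℕ} {c' : ℕ} (h : Valid n r par c f) (hc : c ≤ c') :
    Valid n r par c' f :=
  ⟨h.two, fun k => (h.group k).trans hc⟩

theorem degree_le : degree n a r ≤ n := by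
  simpa [degree] using card_filter_le (range n) fun y => a r y = 1

theorem Rooted.degree_root (hT : Rooted n a r par dep) :
    degree n a r = #(children n r par r) := by
  unfold degree
  congr 1
  ext w
  rw [mem_filter, mem_range, mem_children]
  refine and_congr_right fun hw => ?_
  rw [hT.adj_iff r hT.root_lt w hw]
  simp

theorem Rooted.degree_of_ne (hT : Rooted n a r par dep) {v : ℕ} (hv : v < n) (hr : v ≠ r) :
    degree n a v = #(children n r par v) + 1 := by
  have hnot : par v ∉ children n r par v := by
    intro h
    have h₁ := hT.dep_child h
    have h₂ := hT.dep_par v hv hr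
    omega
  rw [← card_insert_of_notMem hnot]
  unfold degree
  congr 1
  ext w
  rw [mem_filter, mem_range, mem_insert, mem_children]
  constructor
  · rintro ⟨hw, h⟩
    rcases (hT.adj_iff v hv w hw).1 h with h | h
    · exact .inl h.2.symm
    · exact .inr ⟨hw, h⟩
  · rintro (rfl | ⟨hw, h⟩)
    · exact ⟨hT.par_lt v hv hr, (hT.adj_iff v hv _ (hT.par_lt v hv hr)).2 (.inl ⟨hr, rfl⟩)⟩
    · exact ⟨hw, (hT.adj_iff v hv w hw).2 (.inr h)⟩

/-- All edges at the root lie in the two groups of colors `K` and `f r`. Applied with a vertex of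
maximum degree as root, this gives the lower end of the search interval. -/
theorem Rooted.degree_le_two_mul (hT : Rooted n a r par dep) {f : ℕ → ℕ}
    (hf : Valid n r par c f) : degree n a r ≤ 2 * c := by
  obtain ⟨K, hK⟩ := hf.two r hT.root_lt
  rw [hT.degree_root, two_mul]
  calc #(children n r par r)
      ≤ #({x ∈ range n | x ≠ r ∧ f x = K} ∪ {x ∈ range n | x ≠ r ∧ f x = f r}) := by
        refine card_le_card fun w hw => ?_
        have h := mem_children.1 hw
        rw [mem_union, mem_filter, mem_filter, mem_range]
        exact (hK w hw).imp (fun h' => ⟨h.1, h.2.1, h'⟩) fun h' => ⟨h.1, h.2.1, h'⟩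
    _ ≤ c + c := (card_union_le _ _).trans (add_le_add (hf.group _) (hf.group _))

/-- Give the edges from each vertex to its children a color of their own. At a vertex other than the
root this group misses the edge to the parent. At the root one edge, to `w₀`, is split off with the
extra color `n`, which is also the free value at the root and hence admissible there. -/
theorem Rooted.exists_valid (hT : Rooted n a r par dep) (hΔ : ∀ x < n, degree n a x ≤ Δ)
    (h2 : 2 ≤ Δ) : ∃ f, Valid n r par (Δ - 1) f := by
  obtain ⟨w₀, hw₀⟩ : ∃ w₀, w₀ ∈ children n r par r ∨ (w₀ = r ∧ children n r par r = ∅) := by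
    rcases (children n r par r).eq_empty_or_nonempty with h | ⟨w, h⟩
    · exact ⟨r, .inr ⟨rfl, h⟩⟩
    · exact ⟨w, .inl h⟩
  refine ⟨fun x => if x = w₀ ∨ x = r then n else par x, fun v hv => ⟨v, fun w hw => ?_⟩,
    fun k => ?_⟩
  · obtain ⟨hwn, hwr, hwv⟩ := mem_children.1 hw
    by_cases h : w = w₀
    · right
      rcases hw₀ with h₀ | ⟨h₀, -⟩
      · rw [← h] at h₀
        have : v = r := hwv.symm.trans (mem_children.1 h₀).2.2
        simp [h, this]
      · exact absurd (h.trans h₀) hwr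
    · left
      simp [h, hwr, hwv]
  · by_cases hk : k < n
    · have hsub : {x ∈ range n | x ≠ r ∧ (if x = w₀ ∨ x = r then n else par x) = k} ⊆
          (children n r par k).erase w₀ := by
        intro x hx
        simp only [mem_filter, mem_range] at hx
        obtain ⟨hxn, hxr, hx⟩ := hx
        split_ifs at hx with h
        · omega
        · rw [mem_erase, mem_children]
          exact ⟨fun h' => h (.inl h'), hxn, hxr, hx⟩
      have hle := card_le_card hsub
      by_cases hkr : k = r
      · subst hkr
        have h₁ := hΔ k hk
        rw [hT.degree_root] at h₁
        rcases hw₀ with h₀ | ⟨-, h₀⟩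
        · rw [card_erase_of_mem h₀] at hle
          omega
        · rw [h₀, erase_empty, card_empty] at hle
          omega
      · have h₁ := hΔ k hk
        have h₂ := card_erase_le (s := children n r par k) (a := w₀)
        rw [hT.degree_of_ne hk hkr] at h₁
        omega
    · have hsub : {x ∈ range n | x ≠ r ∧ (if x = w₀ ∨ x = r then n else par x) = k} ⊆ {w₀} := by
        intro x hx
        simp only [mem_filter, mem_range] at hx
        obtain ⟨hxn, hxr, hx⟩ := hx
        split_ifs at hx with h
        · exact mem_singleton.2 (h.resolve_right hxr)
        · have := hT.par_lt x hxn hxr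
          omega
      have hle := card_le_card hsub
      rw [card_singleton] at hle
      omega

/-- If no vertex has two neighbors, one color is enough. -/
theorem Rooted.valid_one (hT : Rooted n a r par dep) (hΔ : ∀ x < n, degree n a x ≤ Δ)
    (h1 : Δ ≤ 1) : Valid n r par Δ fun _ => 1 := by
  refine ⟨fun v _ => ⟨1, fun _ _ => .inl rfl⟩, fun k => ?_⟩
  refine le_trans (card_le_card fun x hx => ?_) (hT.degree_root ▸ hΔ r hT.root_lt)
  simp only [mem_filter, mem_range] at hx
  -- A parent other than the root would have degree at least two, so every edge is incident to the
  -- root.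
  refine mem_children.2 ⟨hx.1, hx.2.1, by_contra fun h => ?_⟩
  have hp := hT.par_lt x hx.1 hx.2.1
  have h₁ := hΔ _ hp
  rw [hT.degree_of_ne hp h] at h₁
  have : 0 < #(children n r par (par x)) :=
    card_pos.2 ⟨x, mem_children.2 ⟨hx.1, hx.2.1, rfl⟩⟩
  omega

/-- The memory holds an optimal solution, where `F c` says that there is a solution for the
bound `c`. -/
structure Outcome (n : ℕ) (a : ℕ → ℕ → ℕ) (F : ℕ → Prop) (σ : Memory Reg Arr) : Prop where
  feasible : F (σ.reg .m)
  minimal : ∀ c < σ.reg .m, ¬ F c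
  solution : ∃ r par dep, Rooted n a r par dep ∧ Solution n r par (σ.reg .m) (σ.arr .M)

/-- The search for a fixed root. -/
theorem wp_search {F : ℕ → Prop} (hT : Rooted n a r par dep)
    (hF : ∀ c, F c ↔ ∃ f, Valid n r par c f) (hN : n ≤ N) (hn : σ.reg .n = n)
    (ha : σ.arr .adj = a) (hl : ∀ x < n, σ.arr .label 0 x = dep x + 1) (hr : σ.reg .root = r)
    (hl1 : 1 ≤ σ.reg .l) (hlu : σ.reg .l ≤ σ.reg .u) (hu : σ.reg .u + 1 ≤ N)
    (hs : σ.reg .stored = 0) (hlF : ∀ c < σ.reg .l, ¬ F c) (huF : F (σ.reg .u)) :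
    Wp N (.loop (.not (.and (.eq (.reg .l) (.reg .u)) (.eq (.reg .stored) 1))) testCandidate)
      (fun σ' => F (σ'.reg .u) ∧ (∀ c < σ'.reg .u, ¬ F c) ∧
        Solution n r par (σ'.reg .u) (σ'.arr .U)) σ := by
  have hiff : ∀ σ : Memory Reg Arr, Test.eval σ (.not (.and (.eq (.reg .l) (.reg .u))
      (.eq (.reg .stored) 1))) = true ↔ ¬ (σ.reg .l = σ.reg .u ∧ σ.reg .stored = 1) := by
    intro σ
    simp only [Test.eval, Bool.not_eq_true', ← Bool.not_eq_true, Bool.and_eq_true]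
    exact not_congr (and_congr decide_eq_true_iff decide_eq_true_iff)
  -- The variant is the length of the interval, plus one until a coloring is stored: even when `l =
  -- u` at the start, one test is needed to produce the coloring.
  refine wp_loop (fun j σ' => 1 ≤ σ'.reg .l ∧ σ'.reg .l ≤ σ'.reg .u ∧ σ'.reg .u + 1 ≤ N ∧
    (∀ c < σ'.reg .l, ¬ F c) ∧ F (σ'.reg .u) ∧
    (σ'.reg .stored = 0 ∨ σ'.reg .stored = 1 ∧ Solution n r par (σ'.reg .u) (σ'.arr .U)) ∧
    j = σ'.reg .u - σ'.reg .l + (1 - σ'.reg .stored)) (σ.reg .u - σ.reg .l + 1) (by omega)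
    ⟨hl1, hlu, hu, hlF, huF, .inl hs, by rw [hs]⟩ ?_ ?_
  · rintro j σ₁ hf ⟨hl1, hlu, hu, hlF, huF, hs, rfl⟩ hb
    rw [hiff] at hb
    refine ⟨by omega, ?_⟩
    refine (wp_testCandidate hT hN ((hf.reg .n rfl).trans hn) ((hf.arr .adj rfl).trans ha)
      (by rw [hf.arr .label rfl]; exact hl) ((hf.reg .root rfl).trans hr) rfl (by omega)
      (by omega)).mono ?_
    rintro σ₂ hf₂ (⟨hu₂, hl₂, hs₂, hsol⟩ | ⟨hno, hl₂, hu₂, hs₂, hU₂⟩)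
    · refine ⟨_, ?_, by omega, by omega, by omega, hl₂ ▸ hlF, ?_, .inr ⟨hs₂, hu₂ ▸ hsol⟩, rfl⟩
      · rw [hs₂]
        omega
      · obtain ⟨f, hf, -⟩ := hsol
        rw [hu₂]
        exact (hF _).2 ⟨f, hf⟩
    -- The upper end stays solvable, so a failed candidate lies strictly below it and the interval
    -- remains nonempty.
    · have hne : (σ₁.reg .l + σ₁.reg .u) / 2 ≠ σ₁.reg .u := by
        intro h
        obtain ⟨f, hf⟩ := (hF _).1 huF
        rw [h] at hno
        exact hno f hf
      refine ⟨_, ?_, by omega, by omega, by omega, fun c hc hFc => ?_, hu₂ ▸ huF, ?_, rfl⟩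
      · omega
      · obtain ⟨f, hf⟩ := (hF c).1 hFc
        exact hno f (hf.mono (by omega))
      · rw [hs₂, hu₂, hU₂]
        exact hs
  · rintro j σ₁ hf ⟨hl1, hlu, hu, hlF, huF, hs, rfl⟩ hb
    rw [← Bool.not_eq_true, hiff, not_not] at hb
    refine ⟨huF, hb.1 ▸ hlF, ?_⟩
    rcases hs with hs | hs
    · omega
    · exact hs.2

/-- `F` expresses solvability without reference to a root, which makes the searches for different
roots comparable: each ends with the same least value. -/
theorem wp_treeColoring {F : ℕ → Prop}
    (hF : ∀ r < n, ∃ par dep, Rooted n a r par dep ∧ ∀ c, F c ↔ ∃ f, Valid n r par c f)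
    (h0 : 0 < n) (hn : σ.reg .n = n) (ha : σ.arr .adj = a) :
    Wp n treeColoring (Outcome n a F) σ := by
  refine wp_block_cons ((wp_maxDegree le_rfl hn ha h0).mono ?_)
  rintro σ₁ hf₁ ⟨hΔ, v, hv, hvΔ⟩
  have hn₁ : σ₁.reg .n = n := (hf₁.reg .n rfl).trans hn
  have ha₁ : σ₁.arr .adj = a := (hf₁.arr .adj rfl).trans ha
  generalize hΔ₁ : σ₁.reg .Delta = Δ at hΔ hvΔ
  have hlow : ∀ c, F c → Δ ≤ 2 * c := by
    intro c hc
    obtain ⟨par, dep, hT, h⟩ := hF v hv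
    obtain ⟨f, hf⟩ := (h c).1 hc
    exact hvΔ ▸ hT.degree_le_two_mul hf
  have hΔn : Δ ≤ n := hvΔ ▸ degree_le
  refine wp_block_cons (wp_ite (fun hb => ?_) fun hb => ?_)
  · have h1 : Δ ≤ 1 := by simpa [Test.eval, Exp.eval, hΔ₁] using hb
    refine wp_block_cons (wp_set (wp_block_cons ?_))
    simp only [Exp.eval, hΔ₁]
    refine (wp_fillMatrix .M (e := 1) (F := fun _ _ => 1) (fun _ _ => rfl) le_rfl
      (by simpa [Memory.setReg_reg] using hn₁)).mono fun σ₂ hf₂ hM => ?_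
    have hm : σ₂.reg .m = Δ := by simpa [Memory.setReg_reg] using hf₂.reg .m rfl
    obtain ⟨par, dep, hT, h⟩ := hF 0 h0
    have hval := hT.valid_one hΔ h1
    refine wp_block_nil (wp_block_nil ⟨hm ▸ (h _).2 ⟨_, hval⟩, fun c hc hFc => ?_,
      0, par, dep, hT, _, hm ▸ hval, fun x hx hxr => ?_, fun _ _ => one_ne_zero⟩)
    · have := hlow c hFc
      omega
    · have := hT.par_lt x hx hxr
      exact ⟨hM x hx _ this, hM _ this x hx⟩
  · have h2 : 1 < Δ := by simpa [Test.eval, Exp.eval, hΔ₁] using hb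
    refine wp_block_cons (wp_set (wp_block_cons ?_))
    simp only [Exp.eval, hΔ₁]
    -- Before the first root, `m = Δ - 1` is only a solvable bound with no coloring stored yet.
    refine wp_forTo (fun k σ' => (k = 0 → σ'.reg .m = Δ - 1) ∧ (0 < k → Outcome n a F σ'))
      n le_rfl rfl (by simp [Memory.setReg_reg]) ?_ ?_ ?_
    · intro k σ' hf _
      simpa [Exp.eval, Memory.setReg_reg, hn₁] using hf.reg .n rfl
    · rintro r hr σ₂ hf₂ hrr ⟨hI0, hI⟩
      have hn₂ : σ₂.reg .n = n := by simpa [Memory.setReg_reg, hn₁] using hf₂.reg .n rfl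
      have ha₂ : σ₂.arr .adj = a := by simpa [ha₁] using hf₂.arr .adj rfl
      have hΔ₂ : σ₂.reg .Delta = Δ := by
        simpa [Memory.setReg_reg, hΔ₁] using hf₂.reg .Delta rfl
      obtain ⟨par, dep, hT, h⟩ := hF r hr
      refine wp_block_cons ((wp_labelVertices hT le_rfl hn₂ ha₂ hrr).mono fun σ₃ hf₃ hl₃ => ?_)
      have hn₃ : σ₃.reg .n = n := (hf₃.reg .n rfl).trans hn₂
      have ha₃ : σ₃.arr .adj = a := (hf₃.arr .adj rfl).trans ha₂
      have hΔ₃ : σ₃.reg .Delta = Δ := (hf₃.reg .Delta rfl).trans hΔ₂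
      have hr₃ : σ₃.reg .root = r := (hf₃.reg .root rfl).trans hrr
      have hm₃ : σ₃.reg .m = σ₂.reg .m := hf₃.reg .m rfl
      refine wp_block_cons (wp_set (wp_block_cons (wp_set (wp_block_cons (wp_set
        (wp_block_cons ?_))))))
      simp only [Exp.eval, Memory.setReg_reg, reduceCtorEq, if_false, hΔ₃]
      set τ := ((σ₃.setReg .l ((Δ + 1) / 2)).setReg .u (Δ - 1)).setReg .stored 0 with hτ
      have hlτ : τ.reg .l = (Δ + 1) / 2 := by simp [hτ, Memory.setReg_reg]
      have huτ : τ.reg .u = Δ - 1 := by simp [hτ, Memory.setReg_reg]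
      have hFΔ : F (Δ - 1) := (h _).2 (hT.exists_valid hΔ h2)
      refine (wp_search (F := F) (σ := τ) hT h le_rfl ?_ ha₃ hl₃ ?_ ?_ ?_ ?_ ?_ ?_ ?_).mono ?_
      · simpa [hτ, Memory.setReg_reg] using hn₃
      · simpa [hτ, Memory.setReg_reg] using hr₃
      · omega
      · omega
      · omega
      · simp [hτ, Memory.setReg_reg]
      · intro c hc hFc
        have := hlow c hFc
        omega
      · rwa [huτ]
      rintro σ₄ hf₄ ⟨hFu, hmin, hsol⟩
      have hm₄ : σ₄.reg .m = σ₂.reg .m := by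
        rw [hf₄.reg .m rfl, hτ]
        simpa [Memory.setReg_reg] using hm₃
      have hn₄ : σ₄.reg .n = n := by
        rw [hf₄.reg .n rfl, hτ]
        simpa [Memory.setReg_reg] using hn₃
      -- The current `m` is solvable and `u` is the least solvable value, so the update is always
      -- carried out.
      have hle : σ₄.reg .u ≤ σ₄.reg .m := by
        rw [hm₄]
        by_contra hlt
        rw [not_le] at hlt
        rcases Nat.eq_zero_or_pos r with hr0 | hr0
        · exact hmin _ hlt (hI0 hr0 ▸ hFΔ)
        · exact hmin _ hlt (hI hr0).feasible
      refine wp_block_cons (wp_when (fun _ => ?_) fun hb => ?_)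
      · refine wp_block_cons (wp_set (wp_block_cons ?_))
        simp only [Exp.eval]
        refine (wp_copyColoring (by decide) le_rfl
          (by simpa [Memory.setReg_reg] using hn₄)).mono fun σ₅ hf₅ hM => ?_
        have hm₅ : σ₅.reg .m = σ₄.reg .u := by simpa [Memory.setReg_reg] using hf₅.reg .m rfl
        refine wp_block_nil (wp_block_nil ⟨False.elim, fun _ => ?_⟩)
        have hm₅' : (σ₅.setReg .root (r + 1)).reg .m = σ₄.reg .u := by
          simpa [Memory.setReg_reg] using hm₅
        exact ⟨hm₅' ▸ hFu, hm₅' ▸ hmin, r, par, dep, hT, hm₅' ▸ hsol.congr hT hM⟩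
      · exact absurd hle (of_decide_eq_false hb)
    · exact fun σ' _ hI => wp_block_nil (wp_block_nil (hI.2 h0))

end Main

end MinMaxColoring

namespace MinMaxColoring

/-! ### Translation between graphs and rooted arrays -/

section Trees

open Finset

/-- In a tree, a vertex other than the root has exactly one neighbor closer to the root. -/
theorem exists_parent {V : Type*} {T : SimpleGraph V} (hT : T.IsTree) (r : V) :
    ∃ par : V → V, ∀ x ≠ r, ∀ y, (T.Adj x y ∧ T.dist r x = T.dist r y + 1) ↔ y = par x := by
  -- Extending a shortest path to `y` by the edge to `x` gives a path from `r` to `x` with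
  -- penultimate vertex `y`; uniqueness of paths in a tree then makes `y` unique.
  have hpath : ∀ x y, T.Adj x y → T.dist r x = T.dist r y + 1 →
      ∃ p : T.Walk r x, p.IsPath ∧ p.penultimate = y := by
    intro x y h hd
    obtain ⟨p, hp⟩ := hT.1.exists_walk_length_eq_dist r y
    exact ⟨p.concat h.symm, SimpleGraph.Walk.isPath_of_length_eq_dist _ (by simp [hp, hd]),
      by simp⟩
  have hex : ∀ x ≠ r, ∃ y, T.Adj x y ∧ T.dist r x = T.dist r y + 1 := by
    intro x hx
    obtain ⟨p, hp⟩ := hT.1.exists_walk_length_eq_dist x r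
    cases p with
    | nil => exact absurd rfl hx
    | @cons _ y _ h q =>
      refine ⟨y, h, ?_⟩
      have h₁ := SimpleGraph.dist_le q
      rw [SimpleGraph.Walk.length_cons, SimpleGraph.dist_comm] at hp
      rw [SimpleGraph.dist_comm] at h₁
      rcases hT.dist_eq_dist_add_one_of_adj r h with h₂ | h₂ <;> omega
  choose! par hpar using hex
  refine ⟨par, fun x hx y => ⟨fun h => ?_, fun h => h ▸ hpar x hx⟩⟩
  obtain ⟨p, hp, rfl⟩ := hpath x y h.1 h.2
  obtain ⟨q, hq, h'⟩ := hpath x (par x) (hpar x hx).1 (hpar x hx).2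
  have := (hT.2.subsingleton_path r x).elim ⟨p, hp⟩ ⟨q, hq⟩
  have hpq : p = q := congrArg Subtype.val this
  rw [← h', hpq]

variable {n : ℕ} (T : SimpleGraph (Fin n)) [DecidableRel T.Adj]

theorem input_adj_iff (x y : Fin n) : (input T).arr .adj x y = 1 ↔ T.Adj x y := by
  simp [input]

theorem exists_rooted (hT : T.IsTree) (r : Fin n) :
    ∃ par dep, Rooted n ((input T).arr .adj) r par dep := by
  obtain ⟨par, hpar⟩ := exists_parent hT r
  refine ⟨fun x => if h : x < n then par ⟨x, h⟩ else 0,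
    fun x => if h : x < n then T.dist r ⟨x, h⟩ else 0, r.2, by simp, ?_, ?_, ?_, ?_⟩
  · intro x hx _
    simp [hx]
  · intro x hx hr
    have := ((hpar ⟨x, hx⟩ (fun h => hr (congrArg Fin.val h)) _).2 rfl).2
    simpa [hx] using this
  · intro x hx
    obtain ⟨p, hp, hl⟩ := hT.1.exists_path_of_dist r ⟨x, hx⟩
    have := hp.length_lt
    simpa [hx, ← hl] using this
  · intro x hx y hy
    have hval : ∀ x y : Fin n, x ≠ y ↔ (x : ℕ) ≠ y := fun x y => by rw [ne_eq, Fin.ext_iff]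
    rw [input_adj_iff T ⟨x, hx⟩ ⟨y, hy⟩]
    simp only [hx, hy, dif_pos]
    constructor
    · intro h
      have hr0 : T.dist r r = 0 := SimpleGraph.dist_self
      rcases hT.dist_eq_dist_add_one_of_adj r h with hd | hd
      · have hne : (⟨x, hx⟩ : Fin n) ≠ r := by rintro h'; rw [h', hr0] at hd; omega
        exact .inl ⟨(hval _ _).1 hne, (congrArg Fin.val ((hpar _ hne _).1 ⟨h, hd⟩)).symm⟩
      · have hne : (⟨y, hy⟩ : Fin n) ≠ r := by rintro h'; rw [h', hr0] at hd; omega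
        exact .inr ⟨(hval _ _).1 hne, (congrArg Fin.val ((hpar _ hne _).1 ⟨h.symm, hd⟩)).symm⟩
    · rintro (⟨hr, h⟩ | ⟨hr, h⟩)
      · exact ((hpar ⟨x, hx⟩ ((hval _ _).2 hr) ⟨y, hy⟩).2 (Fin.ext h.symm)).1
      · exact ((hpar ⟨y, hy⟩ ((hval _ _).2 hr) ⟨x, hx⟩).2 (Fin.ext h.symm)).1.symm

variable {T} {r c : ℕ} {par dep : ℕ → ℕ}

theorem Rooted.adj_cases (hT : Rooted n ((input T).arr .adj) r par dep) {x y : Fin n} :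
    T.Adj x y ↔ ((x : ℕ) ≠ r ∧ par x = y) ∨ ((y : ℕ) ≠ r ∧ par y = x) := by
  rw [← input_adj_iff T, hT.adj_iff x x.2 y y.2]

/-- Sending `x` to the edge between `x` and its parent is a bijection from the vertices other than
the root onto the edges. It is injective since two vertices cannot be parents of each other, by
depth. -/
theorem Rooted.encard_group (hT : Rooted n ((input T).arr .adj) r par dep)
    {χ : T.EdgeLabeling ℕ} {f : ℕ → ℕ}
    (hf : ∀ x y : Fin n, ∀ h : T.Adj x y, (x : ℕ) ≠ r → par x = y → χ.get x y h = f x) (k : ℕ) :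
    {e : T.edgeSet | χ e = k}.encard = (#{x ∈ range n | x ≠ r ∧ f x = k} : ℕ∞) := by
  let ι : ℕ → Fin n := fun x => if h : x < n then ⟨x, h⟩ else ⟨r, hT.root_lt⟩
  have hι : ∀ x < n, (ι x : ℕ) = x := fun x hx => by simp [ι, hx]
  rw [← Set.encard_coe_eq_coe_finsetCard, ← Subtype.val_injective.encard_image]
  have hinj : Set.InjOn (fun x => s(ι x, ι (par x)))
      ({x ∈ range n | x ≠ r ∧ f x = k} : Finset ℕ) := by
    intro x hx y hy hxy
    simp only [coe_filter, mem_range, Set.mem_ofPred_eq] at hx hy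
    have hpx := hT.par_lt x hx.1 hx.2.1
    have hpy := hT.par_lt y hy.1 hy.2.1
    rcases Sym2.eq_iff.1 hxy with ⟨h, -⟩ | ⟨h, h'⟩
    · rw [Fin.ext_iff, hι x hx.1, hι y hy.1] at h
      exact h
    · rw [Fin.ext_iff, hι x hx.1, hι _ hpy] at h
      rw [Fin.ext_iff, hι _ hpx, hι y hy.1] at h'
      have h₁ := hT.dep_par x hx.1 hx.2.1
      have h₂ := hT.dep_par y hy.1 hy.2.1
      rw [h'] at h₁
      rw [← h] at h₂
      omega
  rw [← hinj.encard_image]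
  congr 1
  have hget : ∀ x y : Fin n, ∀ h : T.Adj x y, (x : ℕ) ≠ r → par x = y → χ.get x y h = k →
      s(x, y) ∈ (fun x => s(ι x, ι (par x))) ''
        (({x ∈ range n | x ≠ r ∧ f x = k} : Finset ℕ) : Set ℕ) := by
    intro x y h hr hp hk
    refine ⟨x, by simpa using ⟨hr, (hf x y h hr hp).symm.trans hk⟩, ?_⟩
    have h₁ : ι x = x := Fin.ext (hι x x.2)
    have h₂ : ι (par x) = y := by rw [hp]; exact Fin.ext (hι y y.2)
    simp [h₁, h₂]
  ext e
  constructor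
  · rintro ⟨⟨e, he⟩, hk, rfl⟩
    induction e using Sym2.ind with
    | _ x y =>
      have hadj : T.Adj x y := he
      rcases hT.adj_cases.1 hadj with ⟨hr, hp⟩ | ⟨hr, hp⟩
      · exact hget x y hadj hr hp hk
      · show s(x, y) ∈ _
        rw [Sym2.eq_swap]
        refine hget y x hadj.symm hr hp ?_
        rw [← χ.get_comm]
        exact hk
  · rintro ⟨x, hx, rfl⟩
    simp only [coe_filter, mem_range, Set.mem_ofPred_eq] at hx
    have hp : par (ι x) = ι (par x) := by rw [hι x hx.1, hι _ (hT.par_lt x hx.1 hx.2.1)]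
    have hr : (ι x : ℕ) ≠ r := by rw [hι x hx.1]; exact hx.2.1
    have hadj : T.Adj (ι x) (ι (par x)) := hT.adj_cases.2 (.inl ⟨hr, hp⟩)
    refine ⟨⟨_, hadj⟩, ?_, rfl⟩
    have := hf _ _ hadj hr hp
    rw [hι x hx.1, hx.2.2] at this
    exact this

/-- This lets the color of the edge to the parent be named as one of the two colors at a vertex, as
`Valid` requires. -/
theorem exists_subset_pair {s : Set ℕ} (hs : s.encard ≤ 2) {p : ℕ} (hp : p ∈ s) :
    ∃ K, ∀ q ∈ s, q = K ∨ q = p := by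
  rw [← Set.encard_sdiff_singleton_add_one hp, ← one_add_one_eq_two,
    ENat.add_le_add_iff_right (by simp)] at hs
  rcases Set.encard_le_one_iff_eq.1 hs with h | ⟨K, h⟩
  · refine ⟨p, fun q hq => .inr (by_contra fun hqp => ?_)⟩
    have : q ∈ s \ {p} := ⟨hq, hqp⟩
    simp [h] at this
  · refine ⟨K, fun q hq => or_iff_not_imp_right.2 fun hqp => ?_⟩
    have : q ∈ s \ {p} := ⟨hq, hqp⟩
    simpa [h] using this

theorem Rooted.exists_valid_of_coloring (hT : Rooted n ((input T).arr .adj) r par dep)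
    {χ : T.EdgeLabeling ℕ} (h : IsEdgeQColoring 2 χ) (hc : largestGroup χ ≤ c) :
    ∃ f, Valid n r par c f := by
  classical
  -- The value at the root is any color occurring there; if the root has no edge, the default `0` is
  -- harmless.
  obtain ⟨p, hp⟩ : ∃ p, (colorsAt χ ⟨r, hT.root_lt⟩).Nonempty → p ∈ colorsAt χ ⟨r, hT.root_lt⟩ := by
    by_cases h : (colorsAt χ ⟨r, hT.root_lt⟩).Nonempty
    · exact ⟨_, fun _ => h.some_mem⟩
    · exact ⟨0, fun h' => absurd h' h⟩
  have hadj : ∀ x (hx : x < n) (hr : x ≠ r), T.Adj ⟨x, hx⟩ ⟨par x, hT.par_lt x hx hr⟩ :=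
    fun x hx hr => hT.adj_cases.2 (.inl ⟨hr, rfl⟩)
  let f : ℕ → ℕ := fun x => if h : x < n ∧ x ≠ r then χ.get _ _ (hadj x h.1 h.2) else p
  have hfx : ∀ x (hx : x < n) (hr : x ≠ r), f x = χ.get _ _ (hadj x hx hr) :=
    fun x hx hr => by simp [f, hx, hr]
  have hfr : f r = p := by simp [f]
  have hchild : ∀ v (hv : v < n), ∀ w ∈ children n r par v, f w ∈ colorsAt χ ⟨v, hv⟩ := by
    intro v hv w hw
    obtain ⟨hwn, hwr, rfl⟩ := mem_children.1 hw
    rw [hfx w hwn hwr]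
    exact ⟨⟨s(_, _), hadj w hwn hwr⟩, by simp, rfl⟩
  refine ⟨f, fun v hv => ?_, fun k => ?_⟩
  · by_cases hs : (children n r par v).Nonempty
    · obtain ⟨w₀, hw₀⟩ := hs
      have hmem : f v ∈ colorsAt χ ⟨v, hv⟩ := by
        by_cases hvr : v = r
        · subst hvr
          rw [hfr]
          exact hp ⟨_, hchild v hv w₀ hw₀⟩
        · rw [hfx v hv hvr]
          exact ⟨⟨s(_, _), hadj v hv hvr⟩, by simp, rfl⟩
      obtain ⟨K, hK⟩ := exists_subset_pair (h _) hmem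
      exact ⟨K, fun w hw => hK _ (hchild v hv w hw)⟩
    · rw [not_nonempty_iff_eq_empty] at hs
      exact ⟨0, by simp [hs]⟩
  · have := hT.encard_group (χ := χ) (f := f) (fun x y h hr hp => ?_) k
    · have h' := (le_iSup (fun k => {e : T.edgeSet | χ e = k}.encard) k).trans hc
      rw [this] at h'
      exact_mod_cast h'
    · obtain ⟨y, hy⟩ := y
      dsimp only at hp
      subst hp
      exact (hfx x x.2 hr).symm

/-- The matrix is symmetric on edges, so it defines an edge coloring. The last conjunct later
transfers the fact that no value of `f` is `0`, the mark for uncolored, to the edges. -/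
theorem Rooted.exists_coloring (hT : Rooted n ((input T).arr .adj) r par dep) {f : ℕ → ℕ}
    (hf : Valid n r par c f) {m : ℕ → ℕ → ℕ} (hm : Represents n r par m f) :
    ∃ χ : T.EdgeLabeling ℕ, (∀ (x y : Fin n) (h : T.Adj x y), χ.get x y h = m x y) ∧
      IsEdgeQColoring 2 χ ∧ largestGroup χ ≤ c ∧ ∀ e, ∃ x < n, χ e = f x := by
  let χ : T.EdgeLabeling ℕ := SimpleGraph.EdgeLabeling.mk (fun x y _ => m x y) (by
    intro x y h
    rcases hT.adj_cases.1 h with ⟨hr, hp⟩ | ⟨hr, hp⟩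
    · rw [← hp, (hm x x.2 hr).1, (hm x x.2 hr).2]
    · rw [← hp, (hm y y.2 hr).1, (hm y y.2 hr).2])
  have hχ : ∀ (x y : Fin n) (h : T.Adj x y), χ.get x y h = m x y := fun _ _ _ => rfl
  have hg : ∀ x y : Fin n, ∀ h : T.Adj x y, (x : ℕ) ≠ r → par x = y → χ.get x y h = f x := by
    intro x y h hr hp
    rw [hχ, ← hp, (hm x x.2 hr).1]
  refine ⟨χ, hχ, fun v => ?_, iSup_le fun k => ?_, ?_⟩
  · obtain ⟨K, hK⟩ := hf.two v v.2
    refine (Set.encard_le_encard (t := {K, f v}) ?_).trans ?_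
    swap
    · refine (Set.encard_insert_le _ _).trans ?_
      rw [Set.encard_singleton, one_add_one_eq_two]
      exact le_rfl
    rintro _ ⟨⟨e, he⟩, hv, rfl⟩
    obtain ⟨y, rfl⟩ := Sym2.mem_iff_exists.1 hv
    have hadj : T.Adj v y := he
    show χ.get v y hadj = K ∨ χ.get v y hadj = f v
    rcases hT.adj_cases.1 hadj with ⟨hr, hp⟩ | ⟨hr, hp⟩
    · exact .inr (hg v y hadj hr hp)
    · rw [χ.get_comm, hg y v hadj.symm hr hp]
      exact hK y (mem_children.2 ⟨y.2, hr, hp⟩)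
  · rw [hT.encard_group hg k]
    exact_mod_cast hf.group k
  · rintro ⟨e, he⟩
    induction e using Sym2.ind with
    | _ x y =>
      have hadj : T.Adj x y := he
      rcases hT.adj_cases.1 hadj with ⟨hr, hp⟩ | ⟨hr, hp⟩
      · exact ⟨x, x.2, hg x y hadj hr hp⟩
      · refine ⟨y, y.2, ?_⟩
        rw [← hg y x hadj.symm hr hp, ← χ.get_comm]
        rfl

/-- There is a feasible solution all of whose color groups have size at most `c`. -/
def Solvable (T : SimpleGraph (Fin n)) (c : ℕ) : Prop :=
  ∃ χ : T.EdgeLabeling ℕ, IsEdgeQColoring 2 χ ∧ largestGroup χ ≤ c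

theorem Rooted.solvable_iff (hT : Rooted n ((input T).arr .adj) r par dep) :
    Solvable T c ↔ ∃ f, Valid n r par c f := by
  constructor
  · rintro ⟨χ, h, hc⟩
    exact hT.exists_valid_of_coloring h hc
  · rintro ⟨f, hf⟩
    -- The entry for an edge is the value of `f` at its lower end. This is unambiguous because two
    -- vertices are never each other's parents.
    obtain ⟨χ, -, h, hc, -⟩ := hT.exists_coloring hf
      (m := fun x y => if x ≠ r ∧ par x = y then f x else f y) fun x hx hr => by
        refine ⟨by simp [hr], if_neg fun h => ?_⟩
        have h₁ := hT.dep_par x hx hr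
        have h₂ := hT.dep_par _ (hT.par_lt x hx hr) h.1
        rw [h.2] at h₂
        omega
    exact ⟨χ, h, hc⟩

end Trees

end MinMaxColoring

/-! ### The main theorem -/

theorem mainTheorem3 :
    ∃ p : Polynomial ℕ,
      ∀ (n : ℕ) (T : SimpleGraph (Fin n)) [DecidableRel T.Adj], T.IsTree →
        ∃ (t : ℕ) (σ : MinMaxColoring.Memory MinMaxColoring.Reg MinMaxColoring.Arr),
          t ≤ p.eval n ∧
          MinMaxColoring.HaltsIn MinMaxColoring.treeColoring (MinMaxColoring.input T) t σ ∧
          ∃ χ : T.EdgeLabeling ℕ,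
            (∀ (x y : Fin n) (h : T.Adj x y), χ.get x y h = σ.arr MinMaxColoring.Arr.M x y) ∧
            (∀ e : T.edgeSet, χ e ≠ 0) ∧
            MinMaxColoring.IsOptimal 2 χ ∧
            MinMaxColoring.largestGroup χ = (σ.reg MinMaxColoring.Reg.m : ℕ∞) := by
  refine ⟨MinMaxColoring.cost MinMaxColoring.treeColoring, fun n T _ hT => ?_⟩
  have h0 : 0 < n := by
    obtain ⟨x⟩ := hT.1.nonempty
    exact x.pos
  have hroot : ∀ r < n, ∃ par dep, MinMaxColoring.Rooted n
      ((MinMaxColoring.input T).arr .adj) r par dep ∧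
      ∀ c, MinMaxColoring.Solvable T c ↔ ∃ f, MinMaxColoring.Valid n r par c f := by
    intro r hr
    obtain ⟨par, dep, h⟩ := MinMaxColoring.exists_rooted T hT ⟨r, hr⟩
    exact ⟨par, dep, h, fun c => h.solvable_iff⟩
  obtain ⟨t, ht, σ, hrun, hσ⟩ := (MinMaxColoring.wp_treeColoring hroot h0
    (by simp [MinMaxColoring.input]) rfl).haltsIn
  obtain ⟨r, par, dep, hR, f, hf, hrep, hf0⟩ := hσ.solution
  obtain ⟨χ, hget, hcol, hle, hval⟩ := hR.exists_coloring hf hrep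
  have hmin : ∀ χ' : T.EdgeLabeling ℕ, MinMaxColoring.IsEdgeQColoring 2 χ' →
      (σ.reg .m : ℕ∞) ≤ MinMaxColoring.largestGroup χ' := by
    intro χ' h'
    by_contra hlt
    rw [not_le] at hlt
    -- A largest group smaller than `m` has finite size `c`, which would be a solvable bound below
    -- the minimum.
    obtain ⟨c, hc⟩ := ENat.ne_top_iff_exists.1 hlt.ne_top
    rw [← hc] at hlt
    exact hσ.minimal c (by exact_mod_cast hlt) ⟨χ', h', hc.ge⟩
  refine ⟨t, σ, ht, hrun, χ, hget, fun e => ?_, ⟨hcol, fun χ' h' => hle.trans (hmin χ' h')⟩,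
    le_antisymm hle (hmin χ hcol)⟩
  obtain ⟨x, hx, h⟩ := hval e
  rw [h]
  exact hf0 x hx
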